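/- Let $ABC$ be a (nondegenerate) triangle in the Euclidean plane with angles $\alpha,\beta,\gamma$, area $S$ and circumscribed circle $k$, and let $\lambda,\mu,\nu$ be positive numbers. For a point $Y$ of the plane put $F(Y)=\lambda\, AY+\mu\, BY+\nu\, CY$. Two points $X,Y$ are called isogonally conjugate if for each vertex $V$ of the triangle, different from $X$ and $Y$, the lines $VX$ and $VY$ are symmetric with respect to the bisector of the angle of the triangle at $V$. They are isogonally conjugate of type I if moreover both of them are interior points of the triangle or both of them lie on its boundary. The pedal triangle $A_1B_1C_1$ of a point $X$ has as vertices the feet of the perpendiculars from $X$ to the lines $BC$, $CA$, $AB$, respectively. 1) If one of the numbers $\lambda,\mu,\nu$ is greater than or equal to the sum of the other two, then $F$ attains its minimum over the plane exactly at the corresponding vertex ($A$ for $\lambda\ge\mu+\nu$, $B$ for $\mu\ge\nu+\lambda$, $C$ for $\nu\ge\lambda+\mu$). 2) Let $\lambda<\mu+\nu$, $\mu<\nu+\lambda$, $\nu<\lambda+\mu$. Then there exists a triangle with sides $\lambda,\mu,\nu$; let $\alpha_1,\beta_1,\gamma_1$ be its angles opposite to these sides, and put $f(Y)=\sin\alpha_1\,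 AY+\sin\beta_1\, BY+\sin\gamma_1\, CY$. The function $F$ is a positive constant multiple of $f$. There exists a unique point $X$ inside the circle $k$ whose pedal triangle $A_1B_1C_1$ is nondegenerate and has the angles $\angle A_1=\alpha_1$, $\angle B_1=\beta_1$, $\angle C_1=\gamma_1$. Let $R_1$ be the circumradius of $A_1B_1C_1$. a) $X$ is an interior point of triangle $ABC$ if and only if $\alpha+\alpha_1<\pi$, $\beta+\beta_1<\pi$ and $\gamma+\gamma_1<\pi$; $X$ lies on the side $BC$ if and only if $\alpha+\alpha_1=\pi$; $X$ and $A$ lie strictly on opposite sides of the line $BC$ if and only if $\alpha+\alpha_1>\pi$; and similarly for the other two sides. b) If $X$ lies in the closed triangle $ABC$, then there is a unique point $Y$ that is isogonally conjugate of type I to $X$; $F$ attains its minimum exactly at this point, and the minimum of $f$ is $S/R_1$. If $X$ lies on the side $BC$ (respectively $CA$, $AB$), this point is the vertex $A$ (respectively $B$, $C$). c) If $X$ lies outside the closed triangle $ABC$, then there is exactly one side whose line strictly separates $X$ from the opposite vertex. If this side is $BC$, then $F$ attains its minimum exactly at $A$. Moreover, there are then a point $M$ in the interior of the side $BC$ with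 $\angle BXM=\angle MXC$ and a number $q>1$ with $BX=q\,BM$ and $CX=q\,CM$ such that the points at which $F$ attains its minimum are exactly those isogonally conjugate of type I to $M$, and the minimum of $f$ is $qS/R_1$. The analogous statements hold for the sides $CA$ and $AB$. -/

import Mathlib

open EuclideanGeometry MeasureTheory

noncomputable section

namespace FermatWeights

/-- The Euclidean plane. -/
abbrev Plane : Type := EuclideanSpace ℝ (Fin 2)

/-- A nondegenerate triangle `ABC` of the plane. Its vertices are `A = T.points 0`,
`B = T.points 1`, `C = T.points 2`. Indices are taken modulo 3, so that `i + 1` and `i + 2` are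
the two other vertices. -/
abbrev Tri : Type := Affine.Triangle ℝ Plane

/-- The angle of the triangle at the vertex number `i`. -/
def ang (T : Tri) (i : Fin 3) : ℝ :=
  ∠ (T.points (i + 1)) (T.points i) (T.points (i + 2))

/-- The line containing the side opposite to the vertex number `i`. -/
abbrev sideLine (T : Tri) (i : Fin 3) : AffineSubspace ℝ Plane :=
  line[ℝ, T.points (i + 1), T.points (i + 2)]

/-- The length of the side opposite to the vertex number `i`. -/
def sideLength (T : Tri) (i : Fin 3) : ℝ :=
  dist (T.points (i + 1)) (T.points (i + 2))

/-- The area of the triangle. -/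
def area (T : Tri) : ℝ := (volume : Measure Plane).real T.closedInterior

/-- The open disc bounded by the circumscribed circle of the triangle. -/
def circumdisc (T : Tri) : Set Plane := Metric.ball T.circumcenter T.circumradius

/-- The union of the three sides of the triangle. -/
def boundary (T : Tri) : Set Plane := T.closedInterior \ T.interior

/-- `T₁` is the pedal triangle of the point `X` with respect to `T`: its vertex number `i` is the
foot of the perpendicular from `X` to the side line of `T` opposite to the vertex number `i`. -/
def IsPedalTriangle (T : Tri) (X : Plane) (T₁ : Tri) : Prop :=
  ∀ i, T₁.points i = EuclideanGeometry.orthogonalProjection (sideLine T i) X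

/-- The internal bisector line of the angle of the triangle at the vertex number `i`. -/
abbrev bisector (T : Tri) (i : Fin 3) : AffineSubspace ℝ Plane :=
  line[ℝ, T.points i, T.points i +
    (NormedSpace.normalize (T.points (i + 1) - T.points i) +
      NormedSpace.normalize (T.points (i + 2) - T.points i))]

/-- `X` and `Y` are isogonally conjugate with respect to `T`: for every vertex `V` of `T`, the
reflection in the bisector of the angle at `V` carries the line `VX` to the line `VY`.
(The condition at `V` is void if `X` or `Y` is `V`; thus a vertex is conjugate to the points
of the opposite side line.) -/
def IsIsogonalConj (T : Tri) (X Y : Plane) : Prop :=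
  ∀ i, Collinear ℝ {T.points i, EuclideanGeometry.reflection (bisector T i) X, Y}

/-- `X` and `Y` are isogonally conjugate of type I: they are isogonally conjugate, and either
both lie in the interior of the triangle or both lie on its boundary. -/
def IsIsogonalConjTypeI (T : Tri) (X Y : Plane) : Prop :=
  IsIsogonalConj T X Y ∧
    ((X ∈ T.interior ∧ Y ∈ T.interior) ∨ (X ∈ boundary T ∧ Y ∈ boundary T))

/-- The weighted sum of distances `w₀ AY + w₁ BY + w₂ CY`. -/
def weightedSum (T : Tri) (w : Fin 3 → ℝ) (Y : Plane) : ℝ :=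
  ∑ i, w i * dist (T.points i) Y

/-- `Y` is a point of the plane at which `f` attains its minimum over the whole plane. -/
def IsMinimizer (f : Plane → ℝ) (Y : Plane) : Prop := IsMinOn f Set.univ Y

/-- `X` is an interior point of the circumscribed circle of `T`, and `T₁` is its pedal triangle
and has the same angles as `T'` (vertex by vertex). -/
def HasPedalAngles (T T' : Tri) (X : Plane) (T₁ : Tri) : Prop :=
  X ∈ circumdisc T ∧ IsPedalTriangle T X T₁ ∧ ∀ i, ang T₁ i = ang T' i

end FermatWeights

end

/-!
The proof is carried out in barycentric coordinates `x₀, x₁, x₂` of `X` with respect to `T`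
(`bary`). In them, positions with respect to the triangle are sign conditions on the `xᵢ`, the
squared distances to the vertices are quadratic forms whose coefficients come from the squared
sides (`dist_vertex_sq`), the interior of the circumscribed circle is given by positivity of
`power T X = ∑ aᵢ² xᵢ₊₁ xᵢ₊₂` (`mem_circumdisc_iff`, from Leibniz's theorem), and isogonal
conjugation says that the quotients `xᵢ yᵢ / aᵢ²` agree (`collinear_reflection_iff`).

*The point `X`.* The side of the pedal triangle opposite to the foot on `BC` is `AX sin α`
(`dist_foot`). Hence the pedal triangle has the angles of `T'` if and only if `a AX`, `b BX`,
`c CX` are proportional to the weights, with some factor `k`; this is the predicate `IsPole`.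
Computing the sine and the cosine of the angle `α₁` of a triangle with sides proportional to
`a AX`, `b BX`, `c CX` and using the addition formula gives `IsPole.sin_add`: the coordinate `x₀`
is a positive multiple of `sin (α + α₁)`. This settles the position of `X`. It also shows that
the coordinates of `X` are determined up to a factor, hence uniqueness, and it suggests the
coordinates `x₀ ∝ a² (cot α + cot α₁)`, for which the required identities hold
(`exists_isPole`).

*The minimum.* By the Cauchy-Schwarz inequality, a point inside the triangle at which the
weighted unit vectors towards the vertices add up to zero is the only minimizer
(`weightedSum_lt_of_equilibrium`), and a vertex is the only minimizer if the resultant of the pulls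
of the other two is at most its weight (`weightedSum_vertex_lt`). The latter condition is
`cos α + cos α₁ ≤ 0`, that is `α + α₁ ≥ π`, that is `x₀ ≤ 0`. If all coordinates of `X` are
positive, the isogonal conjugate `Y` of `X` satisfies `AY / AX = b c / (S x₁ x₂)` with
`S = ∑ aᵢ² / xᵢ` (`dist_conj`), from which the equilibrium at `Y` follows, and the minimal value is
`a b c / k` by Leibniz's theorem. At the vertex `A` the value is `(BX + CX) / a` times
`a b c / k`; this factor is the number `q`, and `M` is the point dividing `BC` in the ratio
`BX : CX`.
-/

namespace FermatWeights

/-! ### Barycentric coordinates in the plane -/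

/-- The determinant of two vectors of the plane. -/
def cross (u v : Plane) : ℝ := u 0 * v 1 - u 1 * v 0

/-- Twice the signed area of the triangle. -/
def det (T : Tri) : ℝ := cross (T.points 1 - T.points 0) (T.points 2 - T.points 0)

/-- The barycentric coordinates of `X` with respect to `T`, as quotients of signed areas. -/
noncomputable def bary (T : Tri) (X : Plane) (i : Fin 3) : ℝ :=
  cross (T.points (i + 1) - X) (T.points (i + 2) - X) / det T

theorem add_one_add_one (i : Fin 3) : i + 1 + 1 = i + 2 := by fin_cases i <;> rfl
theorem add_one_add_two (i : Fin 3) : i + 1 + 2 = i := by fin_cases i <;> rfl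
theorem add_two_add_one (i : Fin 3) : i + 2 + 1 = i := by fin_cases i <;> rfl
theorem add_two_add_two (i : Fin 3) : i + 2 + 2 = i + 1 := by fin_cases i <;> rfl

theorem sum_cyclic (f : Fin 3 → ℝ) (i : Fin 3) : ∑ j, f j = f i + f (i + 1) + f (i + 2) := by
  rw [Fin.sum_univ_three]
  fin_cases i <;> simp <;> ring

theorem forall_cyclic {p : Fin 3 → Prop} (i : Fin 3) :
    (∀ j, p j) ↔ p i ∧ p (i + 1) ∧ p (i + 2) := by
  have h : (∀ j, p j) ↔ p 0 ∧ p 1 ∧ p 2 := by simp [Fin.forall_fin_succ]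
  rw [h]
  fin_cases i <;> simp <;> tauto

theorem dist_sq (X Y : Plane) : dist X Y ^ 2 = (X 0 - Y 0) ^ 2 + (X 1 - Y 1) ^ 2 := by
  rw [EuclideanSpace.dist_eq, Real.sq_sqrt (by positivity), Fin.sum_univ_two, Real.dist_eq,
    Real.dist_eq, sq_abs, sq_abs]

theorem norm_sq (u : Plane) : ‖u‖ ^ 2 = u 0 ^ 2 + u 1 ^ 2 := by
  simpa using dist_sq u 0

theorem inner_eq (u v : Plane) : inner ℝ u v = u 0 * v 0 + u 1 * v 1 := by
  simp [PiLp.inner_apply, Fin.sum_univ_two, mul_comm]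

theorem plane_ext {X Y : Plane} (h₀ : X 0 = Y 0) (h₁ : X 1 = Y 1) : X = Y := by
  ext i
  fin_cases i
  · exact h₀
  · exact h₁

theorem cross_cyclic (T : Tri) (i : Fin 3) :
    cross (T.points (i + 1) - T.points i) (T.points (i + 2) - T.points i) = det T := by
  fin_cases i <;> simp [cross, det] <;> ring

theorem collinear_iff_cross (P Q R : Plane) :
    Collinear ℝ {P, Q, R} ↔ cross (Q - P) (R - P) = 0 := by
  rw [collinear_iff_of_mem (p₀ := P) (by simp)]
  constructor
  · rintro ⟨v, hv⟩
    obtain ⟨r, hr⟩ := hv Q (by simp)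
    obtain ⟨s, hs⟩ := hv R (by simp)
    subst hr hs
    simp [cross]
    ring
  · intro h
    simp only [cross, PiLp.sub_apply] at h
    by_cases hQ : Q = P
    · refine ⟨R - P, ?_⟩
      subst hQ
      simp only [Set.mem_insert_iff, Set.mem_singleton_iff, forall_eq_or_imp, forall_eq]
      exact ⟨⟨0, by simp⟩, ⟨0, by simp⟩, ⟨1, by simp⟩⟩
    · refine ⟨Q - P, ?_⟩
      simp only [Set.mem_insert_iff, Set.mem_singleton_iff, forall_eq_or_imp, forall_eq]
      refine ⟨⟨0, by simp⟩, ⟨1, by simp⟩, ?_⟩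
      by_cases h0 : Q 0 - P 0 = 0
      · have h1 : Q 1 - P 1 ≠ 0 := fun h1 => hQ (plane_ext (by linarith) (by linarith))
        refine ⟨(R 1 - P 1) / (Q 1 - P 1), plane_ext ?_ ?_⟩
        · have : (Q 1 - P 1) * (R 0 - P 0) = 0 := by rw [h0] at h; linarith
          have := (mul_eq_zero.1 this).resolve_left h1
          simp [h0]; linarith
        · simp; field_simp; ring
      · refine ⟨(R 0 - P 0) / (Q 0 - P 0), plane_ext ?_ ?_⟩
        · simp; field_simp; ring
        · simp; field_simp; linarith

theorem det_ne_zero (T : Tri) : det T ≠ 0 := by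
  intro h
  have h1 := affineIndependent_iff_not_collinear_set (k := ℝ) (p₁ := T.points 0)
    (p₂ := T.points 1) (p₃ := T.points 2)
  rw [collinear_iff_cross] at h1
  have hp : ![T.points 0, T.points 1, T.points 2] = T.points := by
    ext j k
    fin_cases j <;> rfl
  rw [hp] at h1
  exact h1.1 T.independent h

theorem sum_bary (T : Tri) (X : Plane) : ∑ i, bary T X i = 1 := by
  have h := det_ne_zero T
  rw [Fin.sum_univ_three]
  simp only [bary]
  rw [← add_div, ← add_div, div_eq_one_iff_eq h]
  simp [det, cross]
  ring

/-- A point is the barycentre of the vertices with its barycentric coordinates as weights. -/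
theorem eq_sum_bary (T : Tri) (X : Plane) : X = ∑ i, bary T X i • T.points i := by
  have h := det_ne_zero T
  rw [Fin.sum_univ_three]
  simp only [bary]
  apply plane_ext <;>
  · simp only [PiLp.add_apply, PiLp.smul_apply, smul_eq_mul]
    rw [div_mul_eq_mul_div, div_mul_eq_mul_div, div_mul_eq_mul_div, ← add_div, ← add_div,
      eq_div_iff h]
    simp [det, cross]
    ring

theorem bary_sum_smul (T : Tri) (c : Fin 3 → ℝ) (hc : ∑ i, c i = 1) :
    bary T (∑ i, c i • T.points i) = c := by
  have h := det_ne_zero T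
  ext i
  rw [bary, div_eq_iff h]
  rw [Fin.sum_univ_three] at hc ⊢
  have h0 : c 0 = 1 - c 1 - c 2 := by linarith
  fin_cases i <;> simp [cross, det, h0] <;> ring

theorem bary_injective {T : Tri} {X Y : Plane} (h : ∀ i, bary T X i = bary T Y i) : X = Y := by
  rw [eq_sum_bary T X, eq_sum_bary T Y]
  simp [h]

theorem bary_cyclic (T : Tri) (X : Plane) (i : Fin 3) :
    bary T X i + bary T X (i + 1) + bary T X (i + 2) = 1 := by
  rw [← sum_cyclic, sum_bary]

theorem coord_eq (T : Tri) (X : Plane) (i : Fin 3) (j : Fin 2) :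
    X j = bary T X i * T.points i j + bary T X (i + 1) * T.points (i + 1) j +
      bary T X (i + 2) * T.points (i + 2) j := by
  have := congrArg (fun Y : Plane => Y j) (eq_sum_bary T X)
  simp only [Fin.sum_univ_three, PiLp.add_apply, PiLp.smul_apply, smul_eq_mul] at this
  rw [this, ← sum_cyclic (fun k => bary T X k * T.points k j) i, Fin.sum_univ_three]

theorem bary_point_self (T : Tri) (i : Fin 3) : bary T (T.points i) i = 1 := by
  rw [bary, cross_cyclic, div_self (det_ne_zero T)]

theorem bary_point_add_one (T : Tri) (i : Fin 3) : bary T (T.points i) (i + 1) = 0 := by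
  rw [bary, add_one_add_two]
  simp [cross]

theorem bary_point_add_two (T : Tri) (i : Fin 3) : bary T (T.points i) (i + 2) = 0 := by
  rw [bary, add_two_add_one]
  simp [cross]

theorem sideLength_sq (T : Tri) (i : Fin 3) : sideLength T i ^ 2 =
    (T.points (i + 1) 0 - T.points (i + 2) 0) ^ 2 +
      (T.points (i + 1) 1 - T.points (i + 2) 1) ^ 2 := by
  rw [sideLength, dist_sq]

theorem points_ne (T : Tri) (i : Fin 3) : T.points (i + 1) ≠ T.points (i + 2) := by
  intro h
  have := T.independent.injective h
  fin_cases i <;> simp at this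

theorem sideLength_pos (T : Tri) (i : Fin 3) : 0 < sideLength T i :=
  dist_pos.2 (points_ne T i)

/-- Heron's formula: `det T` is twice the area up to sign. -/
theorem heron (T : Tri) (i : Fin 3) :
    4 * det T ^ 2 = 4 * (sideLength T (i + 1) ^ 2 * sideLength T (i + 2) ^ 2) -
      (sideLength T (i + 1) ^ 2 + sideLength T (i + 2) ^ 2 - sideLength T i ^ 2) ^ 2 := by
  rw [← cross_cyclic T i, sideLength_sq, sideLength_sq, sideLength_sq, add_one_add_one,
    add_one_add_two, add_two_add_one, add_two_add_two]
  simp only [cross, PiLp.sub_apply]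
  ring

theorem dist_vertex_sq (T : Tri) (X : Plane) (i : Fin 3) :
    dist (T.points i) X ^ 2 = sideLength T (i + 2) ^ 2 * bary T X (i + 1) ^ 2 +
      sideLength T (i + 1) ^ 2 * bary T X (i + 2) ^ 2 +
      (sideLength T (i + 1) ^ 2 + sideLength T (i + 2) ^ 2 - sideLength T i ^ 2) *
        (bary T X (i + 1) * bary T X (i + 2)) := by
  have h : bary T X i = 1 - bary T X (i + 1) - bary T X (i + 2) := by
    linarith [bary_cyclic T X i]
  rw [sideLength_sq, sideLength_sq, sideLength_sq, add_one_add_one,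
    add_one_add_two, add_two_add_one, add_two_add_two, dist_sq, coord_eq T X i 0,
    coord_eq T X i 1, h]
  ring

/-- The power of `X` with respect to the circumscribed circle, with the sign reversed,
in barycentric coordinates. -/
noncomputable def power (T : Tri) (X : Plane) : ℝ :=
  ∑ i, sideLength T i ^ 2 * (bary T X (i + 1) * bary T X (i + 2))

/-- The theorem of Leibniz on the moment of inertia about a point. -/
theorem leibniz (T : Tri) (X P : Plane) :
    ∑ i, bary T X i * dist (T.points i) P ^ 2 = dist X P ^ 2 + power T X := by
  have h : bary T X 0 = 1 - bary T X 1 - bary T X 2 := by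
    have := bary_cyclic T X 0
    simp only [zero_add] at this
    linarith
  rw [power, Fin.sum_univ_three, Fin.sum_univ_three, sideLength_sq, sideLength_sq, sideLength_sq,
    dist_sq, dist_sq, dist_sq, dist_sq, coord_eq T X 0 0, coord_eq T X 0 1]
  simp only [zero_add, Fin.reduceAdd, h]
  ring

theorem mem_circumdisc_iff (T : Tri) (X : Plane) : X ∈ circumdisc T ↔ 0 < power T X := by
  have h := leibniz T X T.circumcenter
  simp only [Affine.Simplex.dist_circumcenter_eq_circumradius, ← Finset.sum_mul, sum_bary] at h
  have hR := T.circumradius_nonneg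
  rw [circumdisc, Metric.mem_ball, ← sq_lt_sq₀ dist_nonneg hR]
  constructor <;> intro <;> linarith

/-! ### Positions in terms of barycentric coordinates -/

theorem lineMap_coord (P Q : Plane) (t : ℝ) (j : Fin 2) :
    AffineMap.lineMap P Q t j = P j + t * (Q j - P j) := by
  simp [AffineMap.lineMap_apply]
  ring

theorem bary_lineMap (T : Tri) (P Q : Plane) (t : ℝ) (i : Fin 3) :
    bary T (AffineMap.lineMap P Q t) i = (1 - t) * bary T P i + t * bary T Q i := by
  simp only [bary]
  rw [mul_div_assoc', mul_div_assoc', ← add_div]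
  congr 1
  simp only [cross, PiLp.sub_apply, lineMap_coord]
  ring

theorem eq_affineCombination_bary (T : Tri) (X : Plane) :
    X = Finset.univ.affineCombination ℝ T.points (bary T X) := by
  rw [Finset.affineCombination_eq_linear_combination _ _ _ (sum_bary T X), ← eq_sum_bary]

theorem mem_interior_iff (T : Tri) (X : Plane) : X ∈ T.interior ↔ ∀ i, 0 < bary T X i := by
  conv_lhs => rw [eq_affineCombination_bary T X]
  rw [Affine.Simplex.affineCombination_mem_interior_iff (sum_bary T X)]
  refine ⟨fun h i => (h i).1, fun h i => ⟨h i, ?_⟩⟩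
  linarith [bary_cyclic T X i, h (i + 1), h (i + 2)]

theorem mem_closedInterior_iff (T : Tri) (X : Plane) :
    X ∈ T.closedInterior ↔ ∀ i, 0 ≤ bary T X i := by
  conv_lhs => rw [eq_affineCombination_bary T X]
  rw [Affine.Simplex.affineCombination_mem_closedInterior_iff (sum_bary T X)]
  refine ⟨fun h i => (h i).1, fun h i => ⟨h i, ?_⟩⟩
  linarith [bary_cyclic T X i, h (i + 1), h (i + 2)]

theorem mem_boundary_iff (T : Tri) (X : Plane) :
    X ∈ boundary T ↔ (∀ i, 0 ≤ bary T X i) ∧ ∃ i, bary T X i = 0 := by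
  rw [boundary, Set.mem_sdiff, mem_closedInterior_iff, mem_interior_iff]
  push Not
  constructor
  · rintro ⟨h, i, hi⟩
    exact ⟨h, i, le_antisymm hi (h i)⟩
  · rintro ⟨h, i, hi⟩
    exact ⟨h, i, hi.le⟩

theorem mem_sideLine_iff (T : Tri) (X : Plane) (i : Fin 3) :
    X ∈ sideLine T i ↔ bary T X i = 0 := by
  rw [bary, div_eq_zero_iff, or_iff_left (det_ne_zero T)]
  constructor
  · intro h
    have h := collinear_insert_of_mem_affineSpan_pair h
    rwa [collinear_iff_cross] at h
  · intro h
    rw [← collinear_iff_cross] at h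
    exact h.mem_affineSpan_of_mem_of_ne (by simp) (by simp) (by simp) (points_ne T i)

theorem mem_segment_iff (T : Tri) (X : Plane) (i : Fin 3) :
    X ∈ segment ℝ (T.points (i + 1)) (T.points (i + 2)) ↔
      bary T X i = 0 ∧ 0 ≤ bary T X (i + 1) ∧ 0 ≤ bary T X (i + 2) := by
  have a1 := bary_point_self T (i + 1)
  have a2 := bary_point_add_one T (i + 1)
  have a3 := bary_point_add_two T (i + 1)
  have b1 := bary_point_self T (i + 2)
  have b2 := bary_point_add_one T (i + 2)
  have b3 := bary_point_add_two T (i + 2)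
  rw [add_one_add_one] at a2
  rw [add_one_add_two] at a3
  rw [add_two_add_one] at b2
  rw [add_two_add_two] at b3
  rw [segment_eq_image_lineMap]
  constructor
  · rintro ⟨t, ⟨h0, h1⟩, rfl⟩
    simp only [bary_lineMap, a1, a2, a3, b1, b2, b3]
    refine ⟨by ring, by linarith, by linarith⟩
  · rintro ⟨h0, h1, h2⟩
    have hs := bary_cyclic T X i
    refine ⟨bary T X (i + 2), ⟨h2, by linarith⟩, bary_injective (T := T) ((forall_cyclic i).2 ?_)⟩
    simp only [bary_lineMap, a1, a2, a3, b1, b2, b3]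
    refine ⟨by linarith, by linarith, by linarith⟩

theorem sOppSide_iff (T : Tri) (X : Plane) (i : Fin 3) :
    (sideLine T i).SOppSide (T.points i) X ↔ bary T X i < 0 := by
  constructor
  · intro h
    obtain ⟨p, hp, hs⟩ := h.exists_sbtw
    obtain ⟨⟨t, ⟨h0, h1⟩, rfl⟩, hne, hne'⟩ := hs
    rw [mem_sideLine_iff, bary_lineMap, bary_point_self] at hp
    have ht0 : t ≠ 0 := by rintro rfl; simp at hne
    have ht1 : t ≠ 1 := by rintro rfl; simp at hne'
    have ht0' : 0 < t := lt_of_le_of_ne h0 ht0.symm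
    have ht1' : t < 1 := lt_of_le_of_ne h1 ht1
    by_contra hcon
    nlinarith
  · intro h
    have hpos : 0 < 1 - bary T X i := by linarith
    refine Sbtw.sOppSide_of_notMem_of_mem
      (y := AffineMap.lineMap (T.points i) X (1 / (1 - bary T X i)))
      (sbtw_lineMap_iff.2 ⟨?_, by positivity, ?_⟩) ?_ ?_
    · rintro heq
      rw [← heq, bary_point_self] at h
      linarith
    · rw [div_lt_one hpos]
      linarith
    · rw [mem_sideLine_iff, bary_point_self]
      exact one_ne_zero
    · rw [mem_sideLine_iff, bary_lineMap, bary_point_self]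
      field_simp
      ring

/-! ### Feet of perpendiculars and the pedal triangle -/

/-- The foot of the perpendicular from `X` to the side line opposite to the vertex number `i`. -/
noncomputable def foot (T : Tri) (X : Plane) (i : Fin 3) : Plane :=
  EuclideanGeometry.orthogonalProjection (sideLine T i) X

theorem orthogonalProjection_line_coord (P Q X : Plane) (j : Fin 2) :
    dist P Q ^ 2 * ((EuclideanGeometry.orthogonalProjection line[ℝ, P, Q] X : Plane) j - P j) =
      ((X 0 - P 0) * (Q 0 - P 0) + (X 1 - P 1) * (Q 1 - P 1)) * (Q j - P j) := by
  have h1 := EuclideanGeometry.orthogonalProjection_mem (s := line[ℝ, P, Q]) X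
  have h2 := EuclideanGeometry.vsub_orthogonalProjection_mem_direction_orthogonal line[ℝ, P, Q] X
  set F : Plane := (EuclideanGeometry.orthogonalProjection line[ℝ, P, Q] X : Plane) with hF
  rw [mem_affineSpan_pair_iff_exists_lineMap_eq] at h1
  obtain ⟨t, ht⟩ := h1
  have h3 := (Submodule.mem_orthogonal _ _).1 h2 (Q -ᵥ P)
    (AffineSubspace.vsub_mem_direction (right_mem_affineSpan_pair ℝ P Q)
      (left_mem_affineSpan_pair ℝ P Q))
  rw [inner_eq] at h3
  simp only [vsub_eq_sub, PiLp.sub_apply] at h3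
  rw [← ht] at h3 ⊢
  simp only [lineMap_coord] at h3 ⊢
  rw [dist_sq]
  linear_combination (Q j - P j) * (-h3)

theorem foot_coord (T : Tri) (X : Plane) (i : Fin 3) (j : Fin 2) :
    sideLength T i ^ 2 * (foot T X i j - T.points (i + 1) j) =
      ((X 0 - T.points (i + 1) 0) * (T.points (i + 2) 0 - T.points (i + 1) 0) +
        (X 1 - T.points (i + 1) 1) * (T.points (i + 2) 1 - T.points (i + 1) 1)) *
        (T.points (i + 2) j - T.points (i + 1) j) :=
  orthogonalProjection_line_coord _ _ X j

/-- The side of the pedal triangle opposite to the foot number `i` is `AX sin α`, where `A` is the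
vertex number `i` and `α` the angle there. -/
theorem dist_foot_sq (T : Tri) (X : Plane) (i : Fin 3) :
    sideLength T (i + 1) ^ 2 * sideLength T (i + 2) ^ 2 *
        dist (foot T X (i + 1)) (foot T X (i + 2)) ^ 2 =
      dist (T.points i) X ^ 2 * det T ^ 2 := by
  have e := foot_coord T X (i + 1)
  have g := foot_coord T X (i + 2)
  have hb := (sideLength_pos T (i + 1)).ne'
  have hc := (sideLength_pos T (i + 2)).ne'
  have hb2 := sideLength_sq T (i + 1)
  have hc2 := sideLength_sq T (i + 2)
  rw [add_one_add_one, add_one_add_two] at e hb2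
  rw [add_two_add_two, add_two_add_one] at g hc2
  rw [← cross_cyclic T i, dist_sq, dist_sq]
  simp only [cross, PiLp.sub_apply]
  generalize sideLength T (i + 1) = b at *
  generalize sideLength T (i + 2) = c at *
  generalize T.points i = A at *
  generalize T.points (i + 1) = B at *
  generalize T.points (i + 2) = C at *
  generalize foot T X (i + 1) = F at *
  generalize foot T X (i + 2) = G at *
  have e' : ∀ j, b ^ 2 * (F j - A j) =
      ((X 0 - A 0) * (C 0 - A 0) + (X 1 - A 1) * (C 1 - A 1)) * (C j - A j) := by
    intro j
    have := e j
    rw [hb2] at this ⊢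
    linear_combination this
  have hd : ∀ j, b ^ 2 * c ^ 2 * (F j - G j) =
      c ^ 2 * (((X 0 - A 0) * (C 0 - A 0) + (X 1 - A 1) * (C 1 - A 1)) * (C j - A j)) -
      b ^ 2 * (((X 0 - A 0) * (B 0 - A 0) + (X 1 - A 1) * (B 1 - A 1)) * (B j - A j)) := by
    intro j
    rw [← e' j, ← g j]
    ring
  have hbc : b ^ 2 * c ^ 2 ≠ 0 := by positivity
  apply mul_left_cancel₀ hbc
  calc b ^ 2 * c ^ 2 * (b ^ 2 * c ^ 2 * ((F 0 - G 0) ^ 2 + (F 1 - G 1) ^ 2))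
      = (b ^ 2 * c ^ 2 * (F 0 - G 0)) ^ 2 + (b ^ 2 * c ^ 2 * (F 1 - G 1)) ^ 2 := by ring
    _ = _ := by
      rw [hd, hd, hb2, hc2]
      ring

/-- Three points whose distances satisfy the strict triangle inequalities are not collinear. -/
theorem affineIndependent_of_dist_lt (P : Fin 3 → Plane)
    (h : ∀ i, dist (P (i + 1)) (P (i + 2)) < dist (P (i + 2)) (P i) + dist (P i) (P (i + 1))) :
    AffineIndependent ℝ P := by
  rw [affineIndependent_iff_not_collinear]
  intro hc
  have hr : Set.range P = {P 0, P 1, P 2} := by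
    ext Y
    simp [Fin.exists_fin_succ, eq_comm]
  rw [hr] at hc
  have h0 := h 0
  have h1 := h 1
  have h2 := h 2
  simp only [zero_add, Fin.reduceAdd] at h0 h1 h2
  rcases hc.wbtw_or_wbtw_or_wbtw with hw | hw | hw <;>
  · have := hw.dist_add_dist
    simp only [dist_comm (P 1) (P 0), dist_comm (P 2) (P 0), dist_comm (P 2) (P 1)] at *
    linarith

/-! ### Isogonal conjugation in barycentric coordinates -/

theorem sub_coord (T : Tri) (X : Plane) (i : Fin 3) (j : Fin 2) :
    X j - T.points i j = bary T X (i + 1) * (T.points (i + 1) j - T.points i j) +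
      bary T X (i + 2) * (T.points (i + 2) j - T.points i j) := by
  have h : bary T X i = 1 - bary T X (i + 1) - bary T X (i + 2) := by
    linarith [bary_cyclic T X i]
  rw [coord_eq T X i j, h]
  ring

/-- Reflection in the bisector of two vectors `u`, `v` of lengths `c`, `b`, in coordinates: `f` is
the projection of `y u + z v` to the span of `u / c + v / b`. -/
theorem reflection_coord_aux {b c y z : ℝ} {u v f : Fin 2 → ℝ} (hb : 0 < b) (hc : 0 < c)
    (hb2 : b ^ 2 = v 0 ^ 2 + v 1 ^ 2) (hc2 : c ^ 2 = u 0 ^ 2 + u 1 ^ 2)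
    (huv : u 0 * v 1 - u 1 * v 0 ≠ 0)
    (hf : ∀ j, ((c⁻¹ * u 0 + b⁻¹ * v 0) ^ 2 + (c⁻¹ * u 1 + b⁻¹ * v 1) ^ 2) * f j =
      ((y * u 0 + z * v 0) * (c⁻¹ * u 0 + b⁻¹ * v 0) +
        (y * u 1 + z * v 1) * (c⁻¹ * u 1 + b⁻¹ * v 1)) * (c⁻¹ * u j + b⁻¹ * v j)) (j : Fin 2) :
    b * c * (2 * f j - (y * u j + z * v j)) = z * b ^ 2 * u j + y * c ^ 2 * v j := by
  have hpos : 0 < b * c + (u 0 * v 0 + u 1 * v 1) := by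
    have h1 : (u 0 * v 0 + u 1 * v 1) ^ 2 < (b * c) ^ 2 := by
      have : 0 < (u 0 * v 1 - u 1 * v 0) ^ 2 := by positivity
      rw [mul_pow, hb2, hc2]
      nlinarith
    linarith [(abs_lt_of_sq_lt_sq' h1 (by positivity)).1]
  have hbb : b ≠ 0 := hb.ne'
  have hcc : c ≠ 0 := hc.ne'
  have h1 : (c⁻¹ * u 0 + b⁻¹ * v 0) ^ 2 + (c⁻¹ * u 1 + b⁻¹ * v 1) ^ 2 =
      (b * c + (u 0 * v 0 + u 1 * v 1)) / (b * c) * 2 := by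
    field_simp
    linear_combination (-c ^ 2) * hb2 - b ^ 2 * hc2
  have h2 : (y * u 0 + z * v 0) * (c⁻¹ * u 0 + b⁻¹ * v 0) +
      (y * u 1 + z * v 1) * (c⁻¹ * u 1 + b⁻¹ * v 1) =
      (b * c + (u 0 * v 0 + u 1 * v 1)) / (b * c) * (y * c + z * b) := by
    field_simp
    linear_combination (-c * z) * hb2 - b * y * hc2
  have h3 : 2 * f j = (y * c + z * b) * (c⁻¹ * u j + b⁻¹ * v j) := by
    have h4 := hf j
    rw [h1, h2, mul_assoc, mul_assoc] at h4
    exact mul_left_cancel₀ (by positivity) h4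
  rw [h3]
  field_simp
  ring

/-- Reflection in the bisector at `V` exchanges the two sides through `V` up to the ratio of
their lengths. -/
theorem reflection_coord (T : Tri) (X : Plane) (i : Fin 3) (j : Fin 2) :
    sideLength T (i + 1) * sideLength T (i + 2) *
        (EuclideanGeometry.reflection (bisector T i) X j - T.points i j) =
      bary T X (i + 2) * sideLength T (i + 1) ^ 2 * (T.points (i + 1) j - T.points i j) +
        bary T X (i + 1) * sideLength T (i + 2) ^ 2 * (T.points (i + 2) j - T.points i j) := by
  have hb := sideLength_pos T (i + 1)
  have hc := sideLength_pos T (i + 2)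
  have hb2 := sideLength_sq T (i + 1)
  have hc2 := sideLength_sq T (i + 2)
  have hcr := cross_cyclic T i
  have hD := det_ne_zero T
  rw [add_one_add_one, add_one_add_two] at hb2
  rw [add_two_add_two, add_two_add_one] at hc2
  have hnb : ‖T.points (i + 2) - T.points i‖ = sideLength T (i + 1) := by
    rw [← dist_eq_norm, sideLength, add_one_add_one, add_one_add_two]
  have hnc : ‖T.points (i + 1) - T.points i‖ = sideLength T (i + 2) := by
    rw [← dist_eq_norm, dist_comm, sideLength, add_two_add_two, add_two_add_one]
  have hE := orthogonalProjection_line_coord (T.points i) (T.points i +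
    (NormedSpace.normalize (T.points (i + 1) - T.points i) +
      NormedSpace.normalize (T.points (i + 2) - T.points i))) X
  have hX := sub_coord T X i
  have hR : ∀ j, EuclideanGeometry.reflection (bisector T i) X j =
      2 * (EuclideanGeometry.orthogonalProjection (bisector T i) X : Plane) j - X j := by
    intro j
    rw [EuclideanGeometry.reflection_apply']
    simp only [vsub_eq_sub, vadd_eq_add, PiLp.add_apply, PiLp.sub_apply]
    ring
  rw [hR]
  simp only [bisector]
  simp only [NormedSpace.normalize, hnb, hnc, dist_sq, PiLp.add_apply, PiLp.sub_apply,
    PiLp.smul_apply, smul_eq_mul, add_sub_cancel_left, sub_add_cancel_left, neg_sq, hX] at hE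
  simp only [cross, PiLp.sub_apply] at hcr
  rw [← hcr] at hD
  have := reflection_coord_aux (u := fun j => T.points (i + 1) j - T.points i j)
    (v := fun j => T.points (i + 2) j - T.points i j) hb hc hb2 (by rw [hc2]; ring) hD hE j
  rw [← hX] at this
  rw [← this]
  simp only [NormedSpace.normalize, hnb, hnc]
  ring

theorem collinear_reflection_iff (T : Tri) (X Y : Plane) (i : Fin 3) :
    Collinear ℝ {T.points i, EuclideanGeometry.reflection (bisector T i) X, Y} ↔
      sideLength T (i + 1) ^ 2 * (bary T X (i + 2) * bary T Y (i + 2)) =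
        sideLength T (i + 2) ^ 2 * (bary T X (i + 1) * bary T Y (i + 1)) := by
  have hb := (sideLength_pos T (i + 1)).ne'
  have hc := (sideLength_pos T (i + 2)).ne'
  have hD := det_ne_zero T
  have hcr := cross_cyclic T i
  have key : sideLength T (i + 1) * sideLength T (i + 2) *
      cross (EuclideanGeometry.reflection (bisector T i) X - T.points i) (Y - T.points i) =
      det T * (sideLength T (i + 1) ^ 2 * (bary T X (i + 2) * bary T Y (i + 2)) -
        sideLength T (i + 2) ^ 2 * (bary T X (i + 1) * bary T Y (i + 1))) := by
    simp only [cross, PiLp.sub_apply] at hcr ⊢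
    rw [mul_sub, ← mul_assoc, ← mul_assoc, reflection_coord, reflection_coord, sub_coord T Y i 0,
      sub_coord T Y i 1, ← hcr]
    ring
  rw [collinear_iff_cross]
  constructor
  · intro h
    rw [h, mul_zero] at key
    have := (mul_eq_zero.1 key.symm).resolve_left hD
    linarith
  · intro h
    rw [h, sub_self, mul_zero] at key
    exact (mul_eq_zero.1 key).resolve_left (mul_ne_zero hb hc)

/-! ### Trigonometry of a triangle -/

theorem two_mul_cos_ang (T : Tri) (i : Fin 3) :
    2 * (sideLength T (i + 1) * sideLength T (i + 2) * Real.cos (ang T i)) =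
      sideLength T (i + 1) ^ 2 + sideLength T (i + 2) ^ 2 - sideLength T i ^ 2 := by
  have h := EuclideanGeometry.law_cos (T.points (i + 1)) (T.points i) (T.points (i + 2))
  rw [sideLength, sideLength, sideLength, ang, add_one_add_one, add_one_add_two, add_two_add_one,
    add_two_add_two, dist_comm (T.points i) (T.points (i + 1))]
  linear_combination h

theorem ang_mem_Ioo (T : Tri) (i : Fin 3) : ang T i ∈ Set.Ioo 0 Real.pi := by
  have h : ¬ Collinear ℝ {T.points (i + 1), T.points i, T.points (i + 2)} := by
    rw [Set.insert_comm, collinear_iff_cross, cross_cyclic]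
    exact det_ne_zero T
  exact ⟨lt_of_le_of_ne (EuclideanGeometry.angle_nonneg _ _ _)
    (fun h0 => h (EuclideanGeometry.collinear_of_angle_eq_zero h0.symm)),
    lt_of_le_of_ne (EuclideanGeometry.angle_le_pi _ _ _)
    (fun h0 => h (EuclideanGeometry.collinear_of_angle_eq_pi h0))⟩

theorem sin_ang_pos (T : Tri) (i : Fin 3) : 0 < Real.sin (ang T i) :=
  Real.sin_pos_of_mem_Ioo (ang_mem_Ioo T i)

theorem sideLength_mul_sin_ang (T : Tri) (i : Fin 3) :
    sideLength T (i + 1) * sideLength T (i + 2) * Real.sin (ang T i) = |det T| := by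
  have hb := sideLength_pos T (i + 1)
  have hc := sideLength_pos T (i + 2)
  have hs := sin_ang_pos T i
  rw [← abs_of_pos (mul_pos (mul_pos hb hc) hs), ← sq_eq_sq_iff_abs_eq_abs]
  have h1 := two_mul_cos_ang T i
  have h2 := heron T i
  rw [← h1] at h2
  linear_combination (-1 / 4 : ℝ) * h2 + sideLength T (i + 1) ^ 2 * sideLength T (i + 2) ^ 2 *
    Real.sin_sq_add_cos_sq (ang T i)

theorem sum_ang (T : Tri) (i : Fin 3) : ang T i + ang T (i + 1) + ang T (i + 2) = Real.pi := by
  have h := EuclideanGeometry.angle_add_angle_add_angle_eq_pi (p₁ := T.points (i + 1))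
    (p₂ := T.points i) (T.points (i + 2)) (by
      have := points_ne T (i + 2)
      rwa [add_two_add_one, add_two_add_two] at this)
  rw [ang, ang, ang, add_one_add_one, add_one_add_two, add_two_add_one, add_two_add_two, ← h]
  ring

theorem sideLength_eq (T : Tri) (i : Fin 3) :
    sideLength T i = 2 * T.circumradius * Real.sin (ang T i) := by
  have h := T.dist_div_sin_angle_eq_two_mul_circumradius (i₁ := i + 1) (i₂ := i) (i₃ := i + 2)
    (by simp) (by simp) (by simp)
  rw [← h]
  have hs := sin_ang_pos T i
  rw [ang] at hs
  rw [sideLength, ang, div_mul_cancel₀ _ hs.ne']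

theorem circumradius_pos (T : Tri) : 0 < T.circumradius := by
  have h := sideLength_eq T 0
  have h1 := sideLength_pos T 0
  have h2 := sin_ang_pos T 0
  by_contra hcon
  nlinarith

/-- Triangles with proportional sides have the same angles. -/
theorem ang_eq_of_sideLength {T T' : Tri} {r : ℝ} (hr : 0 < r)
    (h : ∀ i, sideLength T i = r * sideLength T' i) (i : Fin 3) : ang T i = ang T' i := by
  have h1 := two_mul_cos_ang T i
  have h2 := two_mul_cos_ang T' i
  have hb := (sideLength_pos T' (i + 1)).ne'
  have hc := (sideLength_pos T' (i + 2)).ne'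
  rw [h, h, h] at h1
  have h3 := ang_mem_Ioo T i
  have h4 := ang_mem_Ioo T' i
  refine Real.injOn_cos ⟨h3.1.le, h3.2.le⟩ ⟨h4.1.le, h4.2.le⟩ ?_
  have h5 : 2 * r ^ 2 * sideLength T' (i + 1) * sideLength T' (i + 2) ≠ 0 := by positivity
  apply mul_left_cancel₀ h5
  linear_combination h1 - r ^ 2 * h2

/-! ### The position of a point with given weighted distances to the vertices -/

theorem power_cyclic (T : Tri) (X : Plane) (i : Fin 3) :
    power T X = sideLength T i ^ 2 * (bary T X (i + 1) * bary T X (i + 2)) +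
      sideLength T (i + 1) ^ 2 * (bary T X (i + 2) * bary T X i) +
      sideLength T (i + 2) ^ 2 * (bary T X i * bary T X (i + 1)) := by
  rw [power, sum_cyclic _ i]
  simp only [add_one_add_one, add_one_add_two, add_two_add_one, add_two_add_two]

/-- With `A`, `B`, `C` the vertices number `i`, `i + 1`, `i + 2` and `a`, `b`, `c` the sides:
the coordinate of `X` at `A` in terms of `a AX`, `b BX`, `c CX` and the power of `X`. -/
theorem two_mul_bary_eq (T : Tri) (X : Plane) (i : Fin 3) :
    2 * (sideLength T (i + 1) ^ 2 * sideLength T (i + 2) ^ 2) * bary T X i =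
      (sideLength T (i + 1) * dist (T.points (i + 1)) X) ^ 2 +
      (sideLength T (i + 2) * dist (T.points (i + 2)) X) ^ 2 -
      (sideLength T i * dist (T.points i) X) ^ 2 +
      (sideLength T (i + 1) ^ 2 + sideLength T (i + 2) ^ 2 - sideLength T i ^ 2) * power T X := by
  have h0 := dist_vertex_sq T X i
  have h1 := dist_vertex_sq T X (i + 1)
  have h2 := dist_vertex_sq T X (i + 2)
  simp only [add_one_add_one, add_one_add_two, add_two_add_one, add_two_add_two] at h1 h2
  have h : bary T X i = 1 - bary T X (i + 1) - bary T X (i + 2) := by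
    linarith [bary_cyclic T X i]
  rw [mul_pow, mul_pow, mul_pow, h0, h1, h2, power_cyclic T X i, h]
  ring

/-- A triangle whose sides are `a AX`, `b BX`, `c CX` has twice the area `|det T| * |power T X|`. -/
theorem det_sq_mul_power_sq (T : Tri) (X : Plane) (i : Fin 3) :
    4 * (det T ^ 2 * power T X ^ 2) =
      4 * ((sideLength T (i + 1) * dist (T.points (i + 1)) X) ^ 2 *
        (sideLength T (i + 2) * dist (T.points (i + 2)) X) ^ 2) -
      ((sideLength T (i + 1) * dist (T.points (i + 1)) X) ^ 2 +
      (sideLength T (i + 2) * dist (T.points (i + 2)) X) ^ 2 -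
      (sideLength T i * dist (T.points i) X) ^ 2) ^ 2 := by
  have h0 := dist_vertex_sq T X i
  have h1 := dist_vertex_sq T X (i + 1)
  have h2 := dist_vertex_sq T X (i + 2)
  simp only [add_one_add_one, add_one_add_two, add_two_add_one, add_two_add_two] at h1 h2
  have h : bary T X i = 1 - bary T X (i + 1) - bary T X (i + 2) := by
    linarith [bary_cyclic T X i]
  rw [← mul_assoc, heron T i]
  rw [mul_pow, mul_pow, mul_pow, h0, h1, h2, power_cyclic T X i, h]
  ring

/-- `X` lies inside the circumscribed circle, and its distances to the vertices, multiplied by the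
opposite sides, are in the ratio `k` to the weights. Equivalently, the sides of its pedal triangle
are proportional to the weights. -/
structure IsPole (T : Tri) (w : Fin 3 → ℝ) (X : Plane) (k : ℝ) : Prop where
  pos : 0 < k
  power_pos : 0 < power T X
  dist_eq : ∀ i, sideLength T i * dist (T.points i) X = k * w i

variable {T T' : Tri} {w : Fin 3 → ℝ} {X : Plane} {k : ℝ}

theorem IsPole.abs_det_eq (h : IsPole T w X k) (hT' : ∀ i, sideLength T' i = w i) :
    |det T| * power T X = k ^ 2 * |det T'| := by
  have hp := h.power_pos
  have h1 := det_sq_mul_power_sq T X 0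
  have h2 := heron T' 0
  simp only [h.dist_eq, hT'] at h1 h2
  rw [← abs_of_pos hp, ← abs_mul, ← abs_of_nonneg (sq_nonneg k), ← abs_mul,
    ← sq_eq_sq_iff_abs_eq_abs]
  linear_combination (1 / 4 : ℝ) * h1 - (1 / 4 : ℝ) * k ^ 4 * h2

/-- The barycentric coordinates of `X` have the signs of the sines of `α + α₁`, `β + β₁`,
`γ + γ₁`. -/
theorem IsPole.sin_add (h : IsPole T w X k) (hT' : ∀ i, sideLength T' i = w i) (i : Fin 3) :
    k ^ 2 * (w (i + 1) * w (i + 2)) * Real.sin (ang T i + ang T' i) =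
      |det T| * (sideLength T (i + 1) * sideLength T (i + 2)) * bary T X i := by
  have hb := (sideLength_pos T (i + 1)).ne'
  have hc := (sideLength_pos T (i + 2)).ne'
  have c1 := two_mul_cos_ang T i
  have c2 := two_mul_cos_ang T' i
  have s1 := sideLength_mul_sin_ang T i
  have s2 := sideLength_mul_sin_ang T' i
  have e := h.abs_det_eq hT'
  have hx := two_mul_bary_eq T X i
  simp only [h.dist_eq] at hx
  simp only [hT'] at c2 s2
  rw [Real.sin_add]
  have hbc : 2 * (sideLength T (i + 1) * sideLength T (i + 2)) ≠ 0 := by positivity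
  apply mul_left_cancel₀ hbc
  linear_combination 2 * k ^ 2 * w (i + 1) * w (i + 2) * Real.cos (ang T' i) * s1 +
    |det T| * k ^ 2 * c2 + k ^ 2 * (2 * (sideLength T (i + 1) * sideLength T (i + 2) *
    Real.cos (ang T i))) * s2 - (2 * (sideLength T (i + 1) * sideLength T (i + 2) *
    Real.cos (ang T i))) * e + |det T| * power T X * c1 - |det T| * hx

theorem sin_pos_iff_lt_pi {θ : ℝ} (h0 : 0 < θ) (h1 : θ < 2 * Real.pi) :
    0 < Real.sin θ ↔ θ < Real.pi := by
  refine ⟨fun h => ?_, Real.sin_pos_of_pos_of_lt_pi h0⟩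
  by_contra hcon
  have h2 := Real.sin_nonneg_of_nonneg_of_le_pi (x := θ - Real.pi) (by linarith) (by linarith)
  rw [Real.sin_sub_pi] at h2
  linarith

theorem sin_neg_iff_pi_lt {θ : ℝ} (h0 : 0 < θ) (h1 : θ < 2 * Real.pi) :
    Real.sin θ < 0 ↔ Real.pi < θ := by
  constructor
  · intro h
    by_contra hcon
    have h2 := Real.sin_nonneg_of_nonneg_of_le_pi h0.le (not_lt.1 hcon)
    linarith
  · intro h
    have h2 := Real.sin_pos_of_pos_of_lt_pi (x := θ - Real.pi) (by linarith) (by linarith)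
    rw [Real.sin_sub_pi] at h2
    linarith

theorem IsPole.bary_pos_iff (h : IsPole T w X k) (hw : ∀ i, 0 < w i)
    (hT' : ∀ i, sideLength T' i = w i) (i : Fin 3) :
    0 < bary T X i ↔ ang T i + ang T' i < Real.pi := by
  have e := h.sin_add hT' i
  have h1 : 0 < k ^ 2 * (w (i + 1) * w (i + 2)) :=
    mul_pos (pow_pos h.pos 2) (mul_pos (hw _) (hw _))
  have h2 : 0 < |det T| * (sideLength T (i + 1) * sideLength T (i + 2)) :=
    mul_pos (abs_pos.2 (det_ne_zero T)) (mul_pos (sideLength_pos T _) (sideLength_pos T _))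
  have a1 := ang_mem_Ioo T i
  have a2 := ang_mem_Ioo T' i
  rw [← sin_pos_iff_lt_pi (add_pos a1.1 a2.1) (by linarith [a1.2, a2.2]),
    ← mul_pos_iff_of_pos_left (b := Real.sin _) h1, e, mul_pos_iff_of_pos_left h2]

theorem IsPole.bary_neg_iff (h : IsPole T w X k) (hw : ∀ i, 0 < w i)
    (hT' : ∀ i, sideLength T' i = w i) (i : Fin 3) :
    bary T X i < 0 ↔ Real.pi < ang T i + ang T' i := by
  have e := h.sin_add hT' i
  have h1 : 0 < k ^ 2 * (w (i + 1) * w (i + 2)) :=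
    mul_pos (pow_pos h.pos 2) (mul_pos (hw _) (hw _))
  have h2 : 0 < |det T| * (sideLength T (i + 1) * sideLength T (i + 2)) :=
    mul_pos (abs_pos.2 (det_ne_zero T)) (mul_pos (sideLength_pos T _) (sideLength_pos T _))
  have a1 := ang_mem_Ioo T i
  have a2 := ang_mem_Ioo T' i
  rw [← sin_neg_iff_pi_lt (add_pos a1.1 a2.1) (by linarith [a1.2, a2.2]),
    ← neg_pos, ← mul_pos_iff_of_pos_left h2,
    ← neg_pos (a := Real.sin _), ← mul_pos_iff_of_pos_left (b := - Real.sin _) h1,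
    mul_neg, mul_neg, e]

theorem IsPole.bary_eq_zero_iff (h : IsPole T w X k) (hw : ∀ i, 0 < w i)
    (hT' : ∀ i, sideLength T' i = w i) (i : Fin 3) :
    bary T X i = 0 ↔ ang T i + ang T' i = Real.pi := by
  have h1 := h.bary_pos_iff hw hT' i
  have h2 := h.bary_neg_iff hw hT' i
  constructor
  · intro h0
    rw [h0] at h1 h2
    have h1 := h1.not.1 (lt_irrefl _)
    have h2 := h2.not.1 (lt_irrefl _)
    exact le_antisymm (not_lt.1 h2) (not_lt.1 h1)
  · intro h0
    rw [h0] at h1 h2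
    have h1 := h1.not.2 (lt_irrefl _)
    have h2 := h2.not.2 (lt_irrefl _)
    exact le_antisymm (not_lt.1 h1) (not_lt.1 h2)

/-! ### Two criteria for the minimum of a weighted sum of distances -/

theorem inner_sub_le (V P Y : Plane) : inner ℝ (V - P) (V - Y) ≤ dist V Y * dist V P := by
  rw [dist_eq_norm, dist_eq_norm, mul_comm]
  exact real_inner_le_norm _ _

theorem inner_sub_lt {V P Y : Plane} (h : cross (V - P) (V - Y) ≠ 0) :
    inner ℝ (V - P) (V - Y) < dist V Y * dist V P := by
  apply lt_of_pow_lt_pow_left₀ 2 (by positivity)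
  rw [mul_pow, dist_sq, dist_sq, inner_eq]
  have h1 : 0 < cross (V - P) (V - Y) ^ 2 := by positivity
  simp only [cross, PiLp.sub_apply] at h1 ⊢
  nlinarith

theorem eq_of_forall_cross_eq_zero {T : Tri} {P Y : Plane}
    (h : ∀ i, cross (T.points i - P) (T.points i - Y) = 0) : P = Y := by
  have hD := det_ne_zero T
  have h0 := h 0
  have h1 := h 1
  have h2 := h 2
  simp only [cross, det, PiLp.sub_apply] at *
  refine plane_ext (sub_eq_zero.1 ((mul_eq_zero.1 ?_).resolve_right hD))
    (sub_eq_zero.1 ((mul_eq_zero.1 ?_).resolve_right hD))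
  · linear_combination (T.points 2 0 - T.points 0 0) * (h1 - h0) -
      (T.points 1 0 - T.points 0 0) * (h2 - h0)
  · linear_combination (T.points 2 1 - T.points 0 1) * (h1 - h0) -
      (T.points 1 1 - T.points 0 1) * (h2 - h0)

theorem isMinimizer_iff_of_lt {f : Plane → ℝ} {Y₀ : Plane} (h : ∀ Y, Y ≠ Y₀ → f Y₀ < f Y)
    (Y : Plane) : IsMinimizer f Y ↔ Y = Y₀ := by
  constructor
  · intro hY
    by_contra hne
    exact absurd (isMinOn_iff.1 hY Y₀ trivial) (not_le.2 (h Y hne))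
  · rintro rfl
    refine isMinOn_iff.2 fun Z _ => ?_
    by_cases hZ : Z = Y
    · rw [hZ]
    · exact (h Z hZ).le

theorem sum_bary_mul_inner (T : Tri) (Y P : Plane) :
    ∑ i, bary T Y i * inner ℝ (T.points i - P) (T.points i - Y) =
      ∑ i, bary T Y i * dist (T.points i) Y ^ 2 := by
  have h : bary T Y 0 = 1 - bary T Y 1 - bary T Y 2 := by
    have := bary_cyclic T Y 0
    simp only [zero_add] at this
    linarith
  rw [Fin.sum_univ_three, Fin.sum_univ_three]
  simp only [inner_eq, dist_sq, PiLp.sub_apply]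
  rw [coord_eq T Y 0 0, coord_eq T Y 0 1]
  simp only [zero_add, h]
  ring

/-- A point at which the weighted unit vectors towards the vertices are in equilibrium. The
equilibrium is expressed by the barycentric coordinates being proportional to the quotients of
the weights by the distances. -/
theorem weightedSum_lt_of_equilibrium {Y : Plane} {τ : ℝ} (hτ : 0 < τ) (hY : ∀ i, 0 < bary T Y i)
    (hw : ∀ i, w i = τ * bary T Y i * dist (T.points i) Y) (P : Plane) (hP : P ≠ Y) :
    weightedSum T w Y < weightedSum T w P := by
  have h1 : weightedSum T w Y =
      ∑ i, τ * bary T Y i * inner ℝ (T.points i - P) (T.points i - Y) := by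
    simp only [mul_assoc, weightedSum, hw]
    rw [← Finset.mul_sum, ← Finset.mul_sum, sum_bary_mul_inner]
    congr 1
    exact Finset.sum_congr rfl fun i _ => by ring
  rw [h1, weightedSum]
  have hc : ∃ i, cross (T.points i - P) (T.points i - Y) ≠ 0 := by
    by_contra hcon
    push Not at hcon
    exact hP (eq_of_forall_cross_eq_zero hcon)
  obtain ⟨i, hi⟩ := hc
  apply Finset.sum_lt_sum
  · intro j _
    rw [hw, mul_assoc (τ * _)]
    exact mul_le_mul_of_nonneg_left (inner_sub_le _ _ _) (mul_pos hτ (hY j)).le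
  · refine ⟨i, Finset.mem_univ _, ?_⟩
    rw [hw, mul_assoc (τ * _)]
    exact mul_lt_mul_of_pos_left (inner_sub_lt hi) (mul_pos hτ (hY i))

theorem weightedSum_vertex (T : Tri) (w : Fin 3 → ℝ) (i : Fin 3) :
    weightedSum T w (T.points i) =
      w (i + 1) * sideLength T (i + 2) + w (i + 2) * sideLength T (i + 1) := by
  rw [weightedSum, sum_cyclic _ i, dist_self, sideLength, sideLength, add_one_add_one,
    add_one_add_two, add_two_add_one, add_two_add_two, dist_comm (T.points i)]
  ring

/-- At a vertex the weighted sum is minimal if the pulls towards the two other vertices add up to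
at most the weight of the vertex. -/
theorem weightedSum_vertex_lt (hw : ∀ i, 0 < w i) (i : Fin 3)
    (hcos : w (i + 1) ^ 2 + w (i + 2) ^ 2 + 2 * (w (i + 1) * w (i + 2) * Real.cos (ang T i)) ≤
      w i ^ 2) (P : Plane) (hP : P ≠ T.points i) :
    weightedSum T w (T.points i) < weightedSum T w P := by
  have hb := sideLength_pos T (i + 1)
  have hc := sideLength_pos T (i + 2)
  have hw1 := hw (i + 1)
  have hw2 := hw (i + 2)
  have hb2 := sideLength_sq T (i + 1)
  have hc2 := sideLength_sq T (i + 2)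
  have ha2 := sideLength_sq T i
  have hA := two_mul_cos_ang T i
  have hdb : dist (T.points (i + 2)) (T.points i) = sideLength T (i + 1) := by
    rw [sideLength, add_one_add_one, add_one_add_two]
  have hdc : dist (T.points (i + 1)) (T.points i) = sideLength T (i + 2) := by
    rw [sideLength, add_two_add_one, add_two_add_two, dist_comm]
  rw [add_one_add_one, add_one_add_two] at hb2
  rw [add_two_add_two, add_two_add_one] at hc2
  have l1 := inner_sub_le (T.points (i + 1)) P (T.points i)
  have l2 := inner_sub_le (T.points (i + 2)) P (T.points i)
  have hstrict : cross (T.points (i + 1) - P) (T.points (i + 1) - T.points i) ≠ 0 ∨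
      cross (T.points (i + 2) - P) (T.points (i + 2) - T.points i) ≠ 0 := by
    by_contra hcon
    push Not at hcon
    exact hP (eq_of_forall_cross_eq_zero (T := T)
      ((forall_cyclic i).2 ⟨by simp [cross], hcon.1, hcon.2⟩))
  -- `e` is the resultant of the pulls towards the two other vertices
  set e : Plane := (w (i + 1) / sideLength T (i + 2)) • (T.points (i + 1) - T.points i) +
    (w (i + 2) / sideLength T (i + 1)) • (T.points (i + 2) - T.points i) with he
  have hen : ‖e‖ ≤ w i := by
    refine le_of_sq_le_sq ?_ (hw i).le
    refine le_trans (le_of_eq ?_) hcos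
    have hg : (T.points (i + 1) 0 - T.points i 0) * (T.points (i + 2) 0 - T.points i 0) +
        (T.points (i + 1) 1 - T.points i 1) * (T.points (i + 2) 1 - T.points i 1) =
        sideLength T (i + 1) * sideLength T (i + 2) * Real.cos (ang T i) := by
      linear_combination (-1 / 2 : ℝ) * hA - (1 / 2 : ℝ) * hb2 - (1 / 2 : ℝ) * hc2 +
        (1 / 2 : ℝ) * ha2
    rw [norm_sq, he]
    simp only [PiLp.add_apply, PiLp.sub_apply, PiLp.smul_apply, smul_eq_mul]
    have e1 : w (i + 1) ^ 2 =
        (w (i + 1) / sideLength T (i + 2)) ^ 2 * sideLength T (i + 2) ^ 2 := by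
      field_simp
    have e2 : w (i + 2) ^ 2 =
        (w (i + 2) / sideLength T (i + 1)) ^ 2 * sideLength T (i + 1) ^ 2 := by
      field_simp
    have e3 : w (i + 1) * w (i + 2) * Real.cos (ang T i) =
        w (i + 1) / sideLength T (i + 2) * (w (i + 2) / sideLength T (i + 1)) *
          (sideLength T (i + 1) * sideLength T (i + 2) * Real.cos (ang T i)) := by
      field_simp
    rw [e1, e2, e3, ← hg, hb2, hc2]
    ring
  have hCS : inner ℝ (P - T.points i) e ≤ w i * dist (T.points i) P := by
    refine (real_inner_le_norm _ _).trans ?_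
    rw [dist_comm, dist_eq_norm, mul_comm]
    exact mul_le_mul_of_nonneg_right hen (norm_nonneg _)
  have hsum : weightedSum T w (T.points i) =
      w (i + 1) / sideLength T (i + 2) *
        inner ℝ (T.points (i + 1) - P) (T.points (i + 1) - T.points i) +
      w (i + 2) / sideLength T (i + 1) *
        inner ℝ (T.points (i + 2) - P) (T.points (i + 2) - T.points i) +
      inner ℝ (P - T.points i) e := by
    have e1 : w (i + 1) * sideLength T (i + 2) =
        w (i + 1) / sideLength T (i + 2) * sideLength T (i + 2) ^ 2 := by
      field_simp
    have e2 : w (i + 2) * sideLength T (i + 1) =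
        w (i + 2) / sideLength T (i + 1) * sideLength T (i + 1) ^ 2 := by
      field_simp
    rw [weightedSum_vertex, e1, e2, hb2, hc2, he]
    simp only [inner_eq, PiLp.add_apply, PiLp.sub_apply, PiLp.smul_apply, smul_eq_mul]
    ring
  rw [hsum, weightedSum, sum_cyclic _ i]
  rw [hdc] at l1
  rw [hdb] at l2
  have m1 := mul_le_mul_of_nonneg_left l1 (div_pos hw1 hc).le
  have m2 := mul_le_mul_of_nonneg_left l2 (div_pos hw2 hb).le
  rw [← mul_assoc, div_mul_cancel₀ _ hc.ne'] at m1
  rw [← mul_assoc, div_mul_cancel₀ _ hb.ne'] at m2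
  rcases hstrict with hs | hs
  · have := mul_lt_mul_of_pos_left (inner_sub_lt hs) (div_pos hw1 hc)
    rw [hdc, ← mul_assoc, div_mul_cancel₀ _ hc.ne'] at this
    linarith
  · have := mul_lt_mul_of_pos_left (inner_sub_lt hs) (div_pos hw2 hb)
    rw [hdb, ← mul_assoc, div_mul_cancel₀ _ hb.ne'] at this
    linarith

/-! ### The minimum in terms of the pole -/

theorem prod_cyclic (f : Fin 3 → ℝ) (i : Fin 3) :
    f 0 * f 1 * f 2 = f i * f (i + 1) * f (i + 2) := by
  fin_cases i <;> simp <;> ring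

theorem isIsogonalConj_iff (T : Tri) (X Y : Plane) : IsIsogonalConj T X Y ↔
    ∀ i, sideLength T (i + 1) ^ 2 * (bary T X (i + 2) * bary T Y (i + 2)) =
        sideLength T (i + 2) ^ 2 * (bary T X (i + 1) * bary T Y (i + 1)) :=
  forall_congr' fun i => collinear_reflection_iff T X Y i

theorem vertex_mem_boundary (T : Tri) (i : Fin 3) : T.points i ∈ boundary T := by
  rw [mem_boundary_iff, forall_cyclic i, bary_point_self, bary_point_add_one, bary_point_add_two]
  exact ⟨⟨zero_le_one, le_rfl, le_rfl⟩, i + 1, bary_point_add_one T i⟩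

/-- The conjugates of type I of an inner point of a side reduce to the opposite vertex. -/
theorem isIsogonalConjTypeI_side_iff {M : Plane} {i : Fin 3} (h0 : bary T M i = 0)
    (h1 : 0 < bary T M (i + 1)) (h2 : 0 < bary T M (i + 2)) (Y : Plane) :
    IsIsogonalConjTypeI T M Y ↔ Y = T.points i := by
  have s0 := (pow_pos (sideLength_pos T i) 2).ne'
  have hint : ¬ M ∈ T.interior := fun h => by
    have := (mem_interior_iff T M).1 h i
    linarith
  rw [IsIsogonalConjTypeI, isIsogonalConj_iff, forall_cyclic i, add_one_add_one, add_one_add_two,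
    add_two_add_one, add_two_add_two, h0]
  constructor
  · rintro ⟨⟨_, e1, e2⟩, _⟩
    have y1 : bary T Y (i + 1) = 0 := by
      rw [zero_mul, mul_zero] at e2
      exact ((mul_eq_zero.1 ((mul_eq_zero.1 e2).resolve_left s0)).resolve_left h1.ne')
    have y2 : bary T Y (i + 2) = 0 := by
      rw [zero_mul, mul_zero] at e1
      exact ((mul_eq_zero.1 ((mul_eq_zero.1 e1.symm).resolve_left s0)).resolve_left h2.ne')
    apply bary_injective (T := T)
    rw [forall_cyclic i, bary_point_self, bary_point_add_one, bary_point_add_two]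
    have := bary_cyclic T Y i
    exact ⟨by linarith, y1, y2⟩
  · rintro rfl
    rw [bary_point_self, bary_point_add_one, bary_point_add_two]
    refine ⟨⟨by ring, by ring, by ring⟩, Or.inr ⟨?_, vertex_mem_boundary T i⟩⟩
    rw [mem_boundary_iff, forall_cyclic i]
    exact ⟨⟨h0.ge, h1.le, h2.le⟩, i, h0⟩

/-- The isogonal conjugate of `X`, with barycentric coordinates proportional to `aᵢ² / xᵢ`. It is
used for interior points only; if some `xᵢ` vanishes, the quotients have junk values. -/
noncomputable def conj (T : Tri) (X : Plane) : Plane :=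
  ∑ i, (sideLength T i ^ 2 / bary T X i / ∑ j, sideLength T j ^ 2 / bary T X j) • T.points i

theorem sum_sq_div_bary_pos (hX : ∀ i, 0 < bary T X i) :
    0 < ∑ j, sideLength T j ^ 2 / bary T X j :=
  Finset.sum_pos (fun j _ => div_pos (pow_pos (sideLength_pos T j) 2) (hX j)) ⟨0, Finset.mem_univ _⟩

theorem bary_conj (hX : ∀ i, 0 < bary T X i) (i : Fin 3) : bary T (conj T X) i =
    sideLength T i ^ 2 / bary T X i / ∑ j, sideLength T j ^ 2 / bary T X j := by
  rw [conj, bary_sum_smul]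
  rw [← Finset.sum_div, div_self (sum_sq_div_bary_pos hX).ne']

theorem bary_conj_pos (hX : ∀ i, 0 < bary T X i) (i : Fin 3) : 0 < bary T (conj T X) i := by
  rw [bary_conj hX]
  exact div_pos (div_pos (pow_pos (sideLength_pos T i) 2) (hX i)) (sum_sq_div_bary_pos hX)

theorem bary_conj_mul (hX : ∀ i, 0 < bary T X i) (i : Fin 3) : bary T (conj T X) i *
    ((∑ j, sideLength T j ^ 2 / bary T X j) * bary T X i) = sideLength T i ^ 2 := by
  rw [bary_conj hX, ← mul_assoc, div_mul_cancel₀ _ (sum_sq_div_bary_pos hX).ne',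
    div_mul_cancel₀ _ (hX i).ne']

theorem isIsogonalConjTypeI_interior_iff (hX : ∀ i, 0 < bary T X i) (Y : Plane) :
    IsIsogonalConjTypeI T X Y ↔ Y = conj T X := by
  have hS := sum_sq_div_bary_pos hX
  rw [IsIsogonalConjTypeI, isIsogonalConj_iff]
  constructor
  · rintro ⟨h, _⟩
    apply bary_injective (T := T)
    intro i
    rw [bary_conj hX]
    have s0 := (sideLength_pos T i).ne'
    have h1 := h (i + 1)
    have h2 := h (i + 2)
    rw [add_one_add_one, add_one_add_two] at h1
    rw [add_two_add_one, add_two_add_two] at h2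
    have e1 : bary T Y (i + 1) = bary T X i * bary T Y i / sideLength T i ^ 2 *
        (sideLength T (i + 1) ^ 2 / bary T X (i + 1)) := by
      have := (hX (i + 1)).ne'
      field_simp
      linarith
    have e2 : bary T Y (i + 2) = bary T X i * bary T Y i / sideLength T i ^ 2 *
        (sideLength T (i + 2) ^ 2 / bary T X (i + 2)) := by
      have := (hX (i + 2)).ne'
      field_simp
      linarith
    have e0 : bary T Y i = bary T X i * bary T Y i / sideLength T i ^ 2 *
        (sideLength T i ^ 2 / bary T X i) := by
      have := (hX i).ne'
      field_simp
    have hsum := bary_cyclic T Y i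
    rw [e1, e2] at hsum
    rw [sum_cyclic _ i] at hS ⊢
    rw [eq_div_iff hS.ne']
    have hxi := (hX i).ne'
    have : bary T X i * bary T Y i / sideLength T i ^ 2 * (sideLength T i ^ 2 / bary T X i +
        sideLength T (i + 1) ^ 2 / bary T X (i + 1) +
        sideLength T (i + 2) ^ 2 / bary T X (i + 2)) = 1 := by
      rw [← hsum, mul_add, mul_add, ← e0]
    have h3 : bary T Y i = sideLength T i ^ 2 / bary T X i *
        (bary T X i * bary T Y i / sideLength T i ^ 2) := by
      field_simp
    rw [h3, mul_assoc, this, mul_one]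
  · rintro rfl
    refine ⟨fun i => ?_, Or.inl ⟨(mem_interior_iff T X).2 hX,
      (mem_interior_iff _ _).2 (bary_conj_pos hX)⟩⟩
    rw [bary_conj hX, bary_conj hX]
    have := (hX (i + 1)).ne'
    have := (hX (i + 2)).ne'
    have := hS.ne'
    field_simp

theorem dist_conj (hX : ∀ i, 0 < bary T X i) (i : Fin 3) :
    dist (T.points i) (conj T X) * ((∑ j, sideLength T j ^ 2 / bary T X j) *
      (bary T X (i + 1) * bary T X (i + 2))) =
      dist (T.points i) X * (sideLength T (i + 1) * sideLength T (i + 2)) := by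
  have hS := sum_sq_div_bary_pos hX
  have h1 := hX (i + 1)
  have h2 := hX (i + 2)
  have hb := sideLength_pos T (i + 1)
  have hc := sideLength_pos T (i + 2)
  have e1 := dist_vertex_sq T X i
  have e2 := dist_vertex_sq T (conj T X) i
  have c1 := bary_conj_mul hX (i + 1)
  have c2 := bary_conj_mul hX (i + 2)
  have hd := dist_nonneg (x := T.points i) (y := X)
  have hd' := dist_nonneg (x := T.points i) (y := conj T X)
  generalize dist (T.points i) X = d at *
  generalize dist (T.points i) (conj T X) = d' at *
  generalize bary T (conj T X) (i + 1) = y₁ at *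
  generalize bary T (conj T X) (i + 2) = y₂ at *
  generalize (∑ j, sideLength T j ^ 2 / bary T X j) = S at *
  refine (sq_eq_sq₀ (by positivity) (by positivity)).1 ?_
  rw [mul_pow d', mul_pow d, e1, e2]
  calc _ = sideLength T (i + 2) ^ 2 * (y₁ * (S * bary T X (i + 1))) ^ 2 * bary T X (i + 2) ^ 2 +
        sideLength T (i + 1) ^ 2 * (y₂ * (S * bary T X (i + 2))) ^ 2 * bary T X (i + 1) ^ 2 +
        (sideLength T (i + 1) ^ 2 + sideLength T (i + 2) ^ 2 - sideLength T i ^ 2) *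
        ((y₁ * (S * bary T X (i + 1))) * (y₂ * (S * bary T X (i + 2))) *
          (bary T X (i + 1) * bary T X (i + 2))) := by ring
    _ = _ := by
      rw [c1, c2]
      ring

theorem IsPole.weightedSum_conj_lt (h : IsPole T w X k) (hX : ∀ i, 0 < bary T X i)
    (P : Plane) (hP : P ≠ conj T X) : weightedSum T w (conj T X) < weightedSum T w P := by
  have hS := sum_sq_div_bary_pos hX
  have hx : 0 < bary T X 0 * bary T X 1 * bary T X 2 := mul_pos (mul_pos (hX 0) (hX 1)) (hX 2)
  have ha : 0 < sideLength T 0 * sideLength T 1 * sideLength T 2 :=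
    mul_pos (mul_pos (sideLength_pos T 0) (sideLength_pos T 1)) (sideLength_pos T 2)
  have hk := h.pos
  refine weightedSum_lt_of_equilibrium
    (τ := (∑ j, sideLength T j ^ 2 / bary T X j) ^ 2 * (bary T X 0 * bary T X 1 * bary T X 2) /
      (k * (sideLength T 0 * sideLength T 1 * sideLength T 2))) (by positivity)
    (bary_conj_pos hX) (fun i => ?_) P hP
  have e := h.dist_eq i
  have e1 := bary_conj_mul hX i
  have e2 := dist_conj hX i
  have hk' := (mul_pos hk ha).ne'
  rw [prod_cyclic (sideLength T) i] at hk' ⊢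
  rw [prod_cyclic (bary T X) i, mul_assoc, div_mul_eq_mul_div, eq_div_iff hk']
  calc _ = (k * w i) * (sideLength T i * sideLength T (i + 1) * sideLength T (i + 2)) := by ring
    _ = sideLength T i ^ 2 * (dist (T.points i) X *
        (sideLength T (i + 1) * sideLength T (i + 2))) := by rw [← e]; ring
    _ = _ := by rw [← e1, ← e2]; ring

theorem IsPole.weightedSum_conj (h : IsPole T w X k) (hX : ∀ i, 0 < bary T X i) :
    weightedSum T w (conj T X) = sideLength T 0 * sideLength T 1 * sideLength T 2 / k := by
  have hS := sum_sq_div_bary_pos hX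
  have hx : 0 < bary T X 0 * bary T X 1 * bary T X 2 := mul_pos (mul_pos (hX 0) (hX 1)) (hX 2)
  have hpow : power T X = (∑ j, sideLength T j ^ 2 / bary T X j) *
      (bary T X 0 * bary T X 1 * bary T X 2) := by
    rw [power, Finset.sum_mul]
    refine Finset.sum_congr rfl fun i _ => ?_
    have := (hX i).ne'
    rw [prod_cyclic (bary T X) i]
    field_simp
  have hl := leibniz T X X
  rw [dist_self, hpow, zero_pow two_ne_zero, zero_add] at hl
  have key : k * weightedSum T w (conj T X) * ((∑ j, sideLength T j ^ 2 / bary T X j) *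
      (bary T X 0 * bary T X 1 * bary T X 2)) =
      sideLength T 0 * sideLength T 1 * sideLength T 2 *
        ∑ i, bary T X i * dist (T.points i) X ^ 2 := by
    rw [weightedSum, Finset.mul_sum, Finset.mul_sum, Finset.sum_mul]
    refine Finset.sum_congr rfl fun i _ => ?_
    have e := h.dist_eq i
    have e2 := dist_conj hX i
    rw [prod_cyclic (sideLength T) i, prod_cyclic (bary T X) i]
    calc _ = (k * w i) * bary T X i * (dist (T.points i) (conj T X) *
          ((∑ j, sideLength T j ^ 2 / bary T X j) *
          (bary T X (i + 1) * bary T X (i + 2)))) := by ring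
      _ = _ := by rw [← e, e2]; ring
  rw [hl] at key
  rw [eq_div_iff h.pos.ne', mul_comm]
  exact mul_right_cancel₀ (mul_pos hS hx).ne' key


theorem IsPole.weightedSum_vertex_lt (h : IsPole T w X k) (hw : ∀ i, 0 < w i)
    (hT' : ∀ i, sideLength T' i = w i) {i : Fin 3} (hi : bary T X i ≤ 0)
    (P : Plane) (hP : P ≠ T.points i) : weightedSum T w (T.points i) < weightedSum T w P := by
  refine FermatWeights.weightedSum_vertex_lt hw i ?_ P hP
  have h1 : Real.pi - ang T' i ≤ ang T i := by
    have := (h.bary_pos_iff hw hT' i).not.1 (not_lt.2 hi)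
    linarith
  have h2 : Real.cos (ang T i) ≤ - Real.cos (ang T' i) := by
    rw [← Real.cos_pi_sub]
    have := ang_mem_Ioo T i
    have := ang_mem_Ioo T' i
    exact Real.cos_le_cos_of_nonneg_of_le_pi (by linarith [this.2])
      (EuclideanGeometry.angle_le_pi _ _ _) h1
  have h3 := two_mul_cos_ang T' i
  rw [hT', hT', hT'] at h3
  have h4 := mul_le_mul_of_nonneg_left h2 (mul_pos (hw (i + 1)) (hw (i + 2))).le
  linarith

theorem IsPole.weightedSum_vertex (h : IsPole T w X k) (i : Fin 3) :
    weightedSum T w (T.points i) = (dist (T.points (i + 1)) X + dist (T.points (i + 2)) X) /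
      sideLength T i * (sideLength T 0 * sideLength T 1 * sideLength T 2 / k) := by
  have hk := h.pos.ne'
  have ha := (sideLength_pos T i).ne'
  rw [FermatWeights.weightedSum_vertex, prod_cyclic (sideLength T) i]
  have h1 := h.dist_eq (i + 1)
  have h2 := h.dist_eq (i + 2)
  field_simp
  linear_combination -sideLength T (i + 2) * h1 - sideLength T (i + 1) * h2

/-! ### Existence and uniqueness of the pole -/

theorem dist_foot (T : Tri) (X : Plane) (i : Fin 3) :
    sideLength T (i + 1) * sideLength T (i + 2) *
        dist (foot T X (i + 1)) (foot T X (i + 2)) = dist (T.points i) X * |det T| := by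
  have hb := sideLength_pos T (i + 1)
  have hc := sideLength_pos T (i + 2)
  refine (sq_eq_sq₀ (by positivity) (by positivity)).1 ?_
  rw [mul_pow, mul_pow, mul_pow, sq_abs, dist_foot_sq]

/-- The ratio between `a AX` and the weights when `T₁` is the pedal triangle of `X` and `T'` the
triangle of the weights: all ratios are given by the circumradii. -/
noncomputable def poleRatio (T T' T₁ : Tri) : ℝ :=
  sideLength T 0 * sideLength T 1 * sideLength T 2 * T₁.circumradius /
    (T'.circumradius * |det T|)

theorem HasPedalAngles.isPole {T₁ : Tri} (h : HasPedalAngles T T' X T₁)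
    (hT' : ∀ i, sideLength T' i = w i) : IsPole T w X (poleRatio T T' T₁) := by
  have hR := circumradius_pos T'
  have hR₁ := circumradius_pos T₁
  have hD := abs_pos.2 (det_ne_zero T)
  have ha := sideLength_pos T
  refine ⟨?_, (mem_circumdisc_iff T X).1 h.1, fun i => ?_⟩
  · have := ha 0
    have := ha 1
    have := ha 2
    unfold poleRatio
    positivity
  · have h1 := dist_foot T X i
    have h2 : dist (foot T X (i + 1)) (foot T X (i + 2)) = sideLength T₁ i := by
      rw [sideLength, h.2.1, h.2.1]
      rfl
    rw [h2, sideLength_eq T₁ i, h.2.2 i] at h1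
    have h3 := sideLength_eq T' i
    rw [hT'] at h3
    rw [poleRatio, prod_cyclic (sideLength T) i, h3]
    field_simp
    linear_combination -sideLength T i * h1

/-- The pole is unique because its barycentric coordinates are determined up to a factor. -/
theorem IsPole.unique {X' : Plane} {k' : ℝ} (hT' : ∀ i, sideLength T' i = w i)
    (h : IsPole T w X k) (h' : IsPole T w X' k') : X = X' := by
  have hD := abs_pos.2 (det_ne_zero T)
  have hx : ∀ i, k' ^ 2 * bary T X i = k ^ 2 * bary T X' i := by
    intro i
    have e := h.sin_add hT' i
    have e' := h'.sin_add hT' i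
    have hb := sideLength_pos T (i + 1)
    have hc := sideLength_pos T (i + 2)
    have : |det T| * (sideLength T (i + 1) * sideLength T (i + 2)) ≠ 0 := by positivity
    apply mul_left_cancel₀ this
    linear_combination k ^ 2 * e' - k' ^ 2 * e
  have hk : k' ^ 2 = k ^ 2 := by
    have e := bary_cyclic T X 0
    have e' := bary_cyclic T X' 0
    linear_combination hx 0 + hx (0 + 1) + hx (0 + 2) - k' ^ 2 * e + k ^ 2 * e'
  refine bary_injective (T := T) fun i => ?_
  have := hx i
  rw [hk] at this
  exact mul_left_cancel₀ (pow_pos h.pos 2).ne' this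

/-- The sum of the cotangents of the angles of `T` and `T'` at the vertex number `i`, up to a
factor which does not depend on `i`. -/
noncomputable def cotSum (T T' : Tri) (i : Fin 3) : ℝ :=
  (sideLength T (i + 1) ^ 2 + sideLength T (i + 2) ^ 2 - sideLength T i ^ 2) * |det T'| +
  (sideLength T' (i + 1) ^ 2 + sideLength T' (i + 2) ^ 2 - sideLength T' i ^ 2) * |det T|

/-- For the point `X` with barycentric coordinates proportional to `aᵢ² * cotSum T T' i`, the left
side is `(a AX)²` up to a factor common to the three vertices; hence `a AX` is proportional to the
corresponding side of `T'`. -/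
theorem sum_sq_mul_cotSum (T T' : Tri) (i : Fin 3) :
    sideLength T (i + 1) ^ 2 * cotSum T T' (i + 1) ^ 2 +
      sideLength T (i + 2) ^ 2 * cotSum T T' (i + 2) ^ 2 +
      (sideLength T (i + 1) ^ 2 + sideLength T (i + 2) ^ 2 - sideLength T i ^ 2) *
        (cotSum T T' (i + 1) * cotSum T T' (i + 2)) =
    2 * |det T| * sideLength T' i ^ 2 * ∑ j, sideLength T j ^ 2 * cotSum T T' j := by
  have h := heron T i
  have h' := heron T' i
  rw [← sq_abs] at h h'
  rw [sum_cyclic _ i]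
  simp only [cotSum]
  rw [add_one_add_one, add_one_add_two, add_two_add_one, add_two_add_two]
  generalize |det T| = δ at *
  generalize |det T'| = δ' at *
  generalize sideLength T i ^ 2 = a at *
  generalize sideLength T (i + 1) ^ 2 = b at *
  generalize sideLength T (i + 2) ^ 2 = c at *
  generalize sideLength T' i ^ 2 = a' at *
  generalize sideLength T' (i + 1) ^ 2 = b' at *
  generalize sideLength T' (i + 2) ^ 2 = c' at *
  linear_combination a * δ ^ 2 * h' - a * δ' ^ 2 * h

/-- The sum on the left is a positive multiple of the power of the point with barycentric coordinates
proportional to `aᵢ² * cotSum T T' i`. -/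
theorem sum_cotSum_mul (T T' : Tri) :
    ∑ i, cotSum T T' (i + 1) * cotSum T T' (i + 2) =
      2 * |det T'| * ∑ j, sideLength T j ^ 2 * cotSum T T' j := by
  have h := heron T 0
  have h' := heron T' 0
  rw [← sq_abs] at h h'
  rw [Fin.sum_univ_three, Fin.sum_univ_three]
  simp only [cotSum, zero_add, Fin.reduceAdd] at *
  generalize |det T| = δ at *
  generalize |det T'| = δ' at *
  generalize sideLength T 0 ^ 2 = a at *
  generalize sideLength T 1 ^ 2 = b at *
  generalize sideLength T 2 ^ 2 = c at *
  generalize sideLength T' 0 ^ 2 = a' at *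
  generalize sideLength T' 1 ^ 2 = b' at *
  generalize sideLength T' 2 ^ 2 = c' at *
  linear_combination δ' ^ 2 * h - δ ^ 2 * h'

theorem sum_sq_mul_cotSum_pos (T T' : Tri) : 0 < ∑ j, sideLength T j ^ 2 * cotSum T T' j := by
  have hD := abs_pos.2 (det_ne_zero T)
  have hD' := abs_pos.2 (det_ne_zero T')
  have h := heron T 0
  rw [← sq_abs] at h
  have e := sum_sq_mul_cotSum T T' 0
  have ha := sideLength_pos T 0
  have hb := sideLength_pos T (0 + 1)
  have ha' := sideLength_pos T' 0
  have hq : 0 < cotSum T T' (0 + 1) + cotSum T T' (0 + 2) := by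
    have : cotSum T T' (0 + 1) + cotSum T T' (0 + 2) =
        2 * (sideLength T 0 ^ 2 * |det T'| + sideLength T' 0 ^ 2 * |det T|) := by
      simp only [cotSum, zero_add, Fin.reduceAdd]
      ring
    rw [this]
    positivity
  generalize cotSum T T' (0 + 1) = q at *
  generalize cotSum T T' (0 + 2) = r at *
  have hpos : 0 < 4 * sideLength T (0 + 1) ^ 2 * (sideLength T (0 + 1) ^ 2 * q ^ 2 +
      sideLength T (0 + 2) ^ 2 * r ^ 2 + (sideLength T (0 + 1) ^ 2 + sideLength T (0 + 2) ^ 2 -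
        sideLength T 0 ^ 2) * (q * r)) := by
    -- complete the square; Heron's formula gives the discriminant
    have : 4 * sideLength T (0 + 1) ^ 2 * (sideLength T (0 + 1) ^ 2 * q ^ 2 +
        sideLength T (0 + 2) ^ 2 * r ^ 2 + (sideLength T (0 + 1) ^ 2 + sideLength T (0 + 2) ^ 2 -
        sideLength T 0 ^ 2) * (q * r)) = (2 * sideLength T (0 + 1) ^ 2 * q +
        (sideLength T (0 + 1) ^ 2 + sideLength T (0 + 2) ^ 2 - sideLength T 0 ^ 2) * r) ^ 2 +
        4 * |det T| ^ 2 * r ^ 2 := by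
      linear_combination -r ^ 2 * h
    rw [this]
    by_cases hr : r = 0
    · have hq' : q ≠ 0 := by
        rintro rfl
        rw [hr] at hq
        simp at hq
      rw [hr, mul_zero, add_zero]
      positivity
    · positivity
  rw [e] at hpos
  have h1 : 0 < 4 * sideLength T (0 + 1) ^ 2 * (2 * |det T| * sideLength T' 0 ^ 2) := by positivity
  rw [← mul_assoc] at hpos
  exact (mul_pos_iff_of_pos_left h1).1 hpos

/-- The pole is the point with barycentric coordinates proportional to `aᵢ² * cotSum T T' i`. -/
theorem exists_isPole (T T' : Tri) : ∃ X k, IsPole T (sideLength T') X k := by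
  have hN := sum_sq_mul_cotSum_pos T T'
  have hD := abs_pos.2 (det_ne_zero T)
  have hD' := abs_pos.2 (det_ne_zero T')
  have ha := sideLength_pos T
  have haaa : 0 < sideLength T 0 * sideLength T 1 * sideLength T 2 :=
    mul_pos (mul_pos (ha 0) (ha 1)) (ha 2)
  have e := sum_sq_mul_cotSum T T'
  have e' := sum_cotSum_mul T T'
  set N := ∑ j, sideLength T j ^ 2 * cotSum T T' j with hNdef
  obtain ⟨X, hx⟩ : ∃ X : Plane, ∀ i, bary T X i = sideLength T i ^ 2 * cotSum T T' i / N := by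
    refine ⟨∑ i, (sideLength T i ^ 2 * cotSum T T' i / N) • T.points i, fun i => ?_⟩
    rw [bary_sum_smul]
    rw [← Finset.sum_div, ← hNdef, div_self hN.ne']
  clear_value N
  refine ⟨X, sideLength T 0 * sideLength T 1 * sideLength T 2 * Real.sqrt (2 * |det T| / N),
    by positivity, ?_, ?_⟩
  · have : power T X = (sideLength T 0 * sideLength T 1 * sideLength T 2) ^ 2 / N ^ 2 *
          ∑ i, cotSum T T' (i + 1) * cotSum T T' (i + 2) := by
      rw [power, Finset.mul_sum]
      refine Finset.sum_congr rfl fun i _ => ?_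
      rw [hx, hx, prod_cyclic (sideLength T) i]
      field_simp
    rw [this, e']
    positivity
  · intro i
    have ha' := sideLength_pos T' i
    have hai := ha i
    have hd : 0 ≤ dist (T.points i) X := dist_nonneg
    have hd2 := dist_vertex_sq T X i
    rw [hx, hx] at hd2
    generalize dist (T.points i) X = d at *
    refine (sq_eq_sq₀ (by positivity) (by positivity)).1 ?_
    rw [mul_pow, hd2, mul_pow, mul_pow, Real.sq_sqrt (by positivity),
      prod_cyclic (sideLength T) i]
    have ei := e i
    have hN0 := hN.ne'
    field_simp
    linear_combination sideLength T (i + 1) ^ 2 * sideLength T (i + 2) ^ 2 * ei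

/-- The pedal triangle of the pole. -/
theorem IsPole.exists_hasPedalAngles (h : IsPole T w X k) (hT' : ∀ i, sideLength T' i = w i)
    (hw : ∀ i, w i < w (i + 1) + w (i + 2)) : ∃ T₁, HasPedalAngles T T' X T₁ := by
  have hD := abs_pos.2 (det_ne_zero T)
  have ha := sideLength_pos T
  have haaa : 0 < sideLength T 0 * sideLength T 1 * sideLength T 2 :=
    mul_pos (mul_pos (ha 0) (ha 1)) (ha 2)
  have hr : 0 < k * |det T| / (sideLength T 0 * sideLength T 1 * sideLength T 2) :=
    div_pos (mul_pos h.pos hD) haaa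
  have hd : ∀ i, dist (foot T X (i + 1)) (foot T X (i + 2)) =
      k * |det T| / (sideLength T 0 * sideLength T 1 * sideLength T 2) * sideLength T' i := by
    intro i
    have h1 := dist_foot T X i
    have h2 := h.dist_eq i
    have := ha i
    have := ha (i + 1)
    have := ha (i + 2)
    rw [hT', prod_cyclic (sideLength T) i, div_mul_eq_mul_div, eq_div_iff (by positivity)]
    linear_combination sideLength T i * h1 + |det T| * h2
  refine ⟨⟨foot T X, affineIndependent_of_dist_lt _ fun i => ?_⟩,
    (mem_circumdisc_iff T X).2 h.power_pos, fun i => rfl, ang_eq_of_sideLength hr hd⟩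
  have h1 := hd (i + 1)
  have h2 := hd (i + 2)
  rw [add_one_add_one, add_one_add_two] at h1
  rw [add_two_add_one, add_two_add_two] at h2
  rw [hd i, h1, h2, ← mul_add, hT', hT', hT']
  exact mul_lt_mul_of_pos_left (hw i) hr

/-- The strict triangle inequalities suffice for a triangle with given sides. -/
theorem exists_triangle (hw : ∀ i, 0 < w i) (h : ∀ i, w i < w (i + 1) + w (i + 2)) :
    ∃ T' : Tri, ∀ i, sideLength T' i = w i := by
  have h0 := hw 0
  have h1 := hw 1
  have h2 := hw 2
  have l0 := h 0
  have l1 := h 1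
  have l2 := h 2
  simp only [zero_add, Fin.reduceAdd] at l0 l1 l2
  -- the side number `0` lies on the first axis
  set x : ℝ := (w 0 ^ 2 + w 2 ^ 2 - w 1 ^ 2) / (2 * w 0) with hx
  have hx' : 2 * w 0 * x = w 0 ^ 2 + w 2 ^ 2 - w 1 ^ 2 := by
    rw [hx]
    field_simp
  have hy : 0 ≤ w 2 ^ 2 - x ^ 2 := by
    have : 0 < (w 0 + w 1 + w 2) * (w 1 + w 2 - w 0) * (w 2 + w 0 - w 1) * (w 0 + w 1 - w 2) := by
      have a1 : 0 < w 1 + w 2 - w 0 := by linarith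
      have a2 : 0 < w 2 + w 0 - w 1 := by linarith
      have a3 : 0 < w 0 + w 1 - w 2 := by linarith
      positivity
    have h4 : 0 < (2 * w 0) ^ 2 := by positivity
    refine le_of_mul_le_mul_left ?_ h4
    have : (2 * w 0) ^ 2 * (w 2 ^ 2 - x ^ 2) =
        (w 0 + w 1 + w 2) * (w 1 + w 2 - w 0) * (w 2 + w 0 - w 1) * (w 0 + w 1 - w 2) := by
      linear_combination (-2 * w 0 * x - (w 0 ^ 2 + w 2 ^ 2 - w 1 ^ 2)) * hx'
    rw [this, mul_zero]
    positivity
  have hsq := Real.sq_sqrt hy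
  set P : Fin 3 → Plane := ![!₂[x, Real.sqrt (w 2 ^ 2 - x ^ 2)], !₂[0, 0], !₂[w 0, 0]] with hP
  have d : ∀ i, dist (P (i + 1)) (P (i + 2)) = w i := by
    intro i
    refine (sq_eq_sq₀ dist_nonneg (hw i).le).1 ?_
    rw [dist_sq]
    fin_cases i
    · simp [hP]
    · simp [hP, hsq]
      linear_combination -hx'
    · simp [hP, hsq]
  refine ⟨⟨P, affineIndependent_of_dist_lt _ fun i => ?_⟩, d⟩
  have d1 := d (i + 1)
  have d2 := d (i + 2)
  rw [add_one_add_one, add_one_add_two] at d1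
  rw [add_two_add_one, add_two_add_two] at d2
  rw [d, d1, d2]
  exact h i

/-! ### The area of a triangle -/

/-- The standard triangle of the plane has area `1 / 2`. -/
theorem volume_standard_triangle :
    (volume : Measure Plane) {v | 0 ≤ v 0 ∧ 0 ≤ v 1 ∧ v 0 + v 1 ≤ 1} = ENNReal.ofReal (1 / 2) := by
  have hmeas : MeasurableSet {p : ℝ × ℝ | 0 ≤ p.1 ∧ 0 ≤ p.2 ∧ p.1 + p.2 ≤ 1} := by
    apply IsClosed.measurableSet
    exact (isClosed_le continuous_const continuous_fst).inter
      ((isClosed_le continuous_const continuous_snd).inter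
        (isClosed_le (continuous_fst.add continuous_snd) continuous_const))
  have m := (MeasureTheory.volume_preserving_finTwoArrow ℝ).comp
    (PiLp.volume_preserving_ofLp (Fin 2))
  have h1 := m.measure_preimage hmeas.nullMeasurableSet
  have h2 : (⇑MeasurableEquiv.finTwoArrow ∘ WithLp.ofLp) ⁻¹'
      {p : ℝ × ℝ | 0 ≤ p.1 ∧ 0 ≤ p.2 ∧ p.1 + p.2 ≤ 1} =
      {v : Plane | 0 ≤ v 0 ∧ 0 ≤ v 1 ∧ v 0 + v 1 ≤ 1} := by
    ext v
    simp [MeasurableEquiv.finTwoArrow]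
  rw [h2] at h1
  rw [h1, Measure.volume_eq_prod, Measure.prod_apply hmeas]
  have h3 : ∀ x : ℝ, volume (Prod.mk x ⁻¹' {p : ℝ × ℝ | 0 ≤ p.1 ∧ 0 ≤ p.2 ∧ p.1 + p.2 ≤ 1}) =
      (Set.Icc (0 : ℝ) 1).indicator (fun x => ENNReal.ofReal (1 - x)) x := by
    intro x
    by_cases hx : x ∈ Set.Icc (0 : ℝ) 1
    · have : Prod.mk x ⁻¹' {p : ℝ × ℝ | 0 ≤ p.1 ∧ 0 ≤ p.2 ∧ p.1 + p.2 ≤ 1} = Set.Icc 0 (1 - x) := by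
        ext y
        simp only [Set.mem_preimage, Set.mem_ofPred_eq, Set.mem_Icc]
        constructor
        · rintro ⟨_, h, h'⟩
          exact ⟨h, by linarith⟩
        · rintro ⟨h, h'⟩
          exact ⟨hx.1, h, by linarith⟩
      rw [this, Set.indicator_of_mem hx, Real.volume_Icc, sub_zero]
    · have : Prod.mk x ⁻¹' {p : ℝ × ℝ | 0 ≤ p.1 ∧ 0 ≤ p.2 ∧ p.1 + p.2 ≤ 1} = ∅ := by
        ext y
        simp only [Set.mem_preimage, Set.mem_ofPred_eq, Set.mem_empty_iff_false, iff_false]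
        rintro ⟨h0, h, h'⟩
        exact hx ⟨h0, by linarith⟩
      rw [this, Set.indicator_of_notMem hx, measure_empty]
  simp_rw [h3]
  rw [lintegral_indicator measurableSet_Icc, ← ofReal_integral_eq_lintegral_ofReal]
  · rw [integral_Icc_eq_integral_Ioc, ← intervalIntegral.integral_of_le zero_le_one]
    congr 1
    rw [intervalIntegral.integral_sub (by simp) (by simp)]
    simp
    norm_num
  · exact (continuous_const.sub continuous_id).integrableOn_Icc
  · filter_upwards [ae_restrict_mem measurableSet_Icc] with x hx
    simpa using hx.2

theorem area_eq (T : Tri) : area T = |det T| / 2 := by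
  set M : Matrix (Fin 2) (Fin 2) ℝ :=
    !![T.points 1 0 - T.points 0 0, T.points 2 0 - T.points 0 0;
      T.points 1 1 - T.points 0 1, T.points 2 1 - T.points 0 1] with hM
  have hdet : LinearMap.det (Matrix.toLpLin 2 2 M) = det T := by
    rw [Matrix.toLpLin_eq_toLin, LinearMap.det_toLin, hM, Matrix.det_fin_two_of, det, cross]
    simp only [PiLp.sub_apply]
    ring
  have hL : ∀ v : Plane, ∀ j, Matrix.toLpLin 2 2 M v j =
      (T.points 1 j - T.points 0 j) * v 0 + (T.points 2 j - T.points 0 j) * v 1 := by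
    intro v j
    fin_cases j <;> simp [hM, Matrix.toLpLin_apply, dotProduct]
  have hset : T.closedInterior = (fun X => X + -T.points 0) ⁻¹'
      (Matrix.toLpLin 2 2 M '' {v : Plane | 0 ≤ v 0 ∧ 0 ≤ v 1 ∧ v 0 + v 1 ≤ 1}) := by
    ext X
    rw [mem_closedInterior_iff, Set.mem_preimage, forall_cyclic 0]
    simp only [zero_add]
    have hs := bary_cyclic T X 0
    simp only [zero_add] at hs
    constructor
    · rintro ⟨h0, h1, h2⟩
      refine ⟨!₂[bary T X 1, bary T X 2], ⟨by simpa using h1, by simpa using h2, ?_⟩, ?_⟩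
      · simp
        linarith
      · have hc := sub_coord T X 0
        simp only [zero_add] at hc
        ext j
        rw [hL, PiLp.add_apply, PiLp.neg_apply, ← sub_eq_add_neg, hc]
        simp
        ring
    · rintro ⟨v, ⟨h0, h1, h2⟩, hv⟩
      have hX : X = ∑ i, (![1 - v 0 - v 1, v 0, v 1] : Fin 3 → ℝ) i • T.points i := by
        ext j
        have := congrArg (fun Y : Plane => Y j) hv
        simp only [hL, PiLp.add_apply, PiLp.neg_apply] at this
        simp [Fin.sum_univ_three]
        linarith
      have hb := bary_sum_smul T ![1 - v 0 - v 1, v 0, v 1] (by simp [Fin.sum_univ_three]; ring)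
      rw [← hX] at hb
      rw [hb]
      exact ⟨by simp; linarith, by simpa using h0, by simpa using h1⟩
  rw [area, Measure.real, hset, measure_preimage_add_right, Measure.addHaar_image_linearMap, hdet,
    volume_standard_triangle, ← ENNReal.ofReal_mul (abs_nonneg _),
    ENNReal.toReal_ofReal (by positivity)]
  ring

/-! ### The point on a side seen from the pole under equal angles -/

/-- The vector `‖v‖ u + ‖u‖ v` bisects the angle between `u` and `v`. -/
theorem angle_bisector_eq {u v : Plane} (hu : 0 < ‖u‖) (hv : 0 < ‖v‖) :
    InnerProductGeometry.angle u (‖v‖ • u + ‖u‖ • v) =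
      InnerProductGeometry.angle (‖v‖ • u + ‖u‖ • v) v := by
  rw [InnerProductGeometry.angle, InnerProductGeometry.angle]
  congr 1
  rw [inner_add_right, inner_add_left, real_inner_smul_right, real_inner_smul_right,
    real_inner_smul_left, real_inner_smul_left, real_inner_self_eq_norm_sq,
    real_inner_self_eq_norm_sq]
  generalize ‖‖v‖ • u + ‖u‖ • v‖ = n
  by_cases hn : n = 0
  · simp [hn]
  · field_simp
    ring

theorem exists_bisecting_point {i : Fin 3} (hX : bary T X i < 0) :
    ∃ (M : Plane) (q : ℝ), Sbtw ℝ (T.points (i + 1)) M (T.points (i + 2)) ∧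
      ∠ (T.points (i + 1)) X M = ∠ M X (T.points (i + 2)) ∧ 1 < q ∧
      dist (T.points (i + 1)) X = q * dist (T.points (i + 1)) M ∧
      dist (T.points (i + 2)) X = q * dist (T.points (i + 2)) M ∧
      q = (dist (T.points (i + 1)) X + dist (T.points (i + 2)) X) / sideLength T i := by
  have ha := sideLength_pos T i
  have hseg : X ∉ segment ℝ (T.points (i + 1)) (T.points (i + 2)) := fun h => by
    have := ((mem_segment_iff T X i).1 h).1
    linarith
  have hB : X ≠ T.points (i + 1) := by
    rintro rfl
    exact hseg (left_mem_segment _ _ _)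
  have hC : X ≠ T.points (i + 2) := by
    rintro rfl
    exact hseg (right_mem_segment _ _ _)
  have hβ : 0 < dist (T.points (i + 1)) X := dist_pos.2 hB.symm
  have hγ : 0 < dist (T.points (i + 2)) X := dist_pos.2 hC.symm
  have hlt : sideLength T i < dist (T.points (i + 1)) X + dist (T.points (i + 2)) X := by
    rw [dist_comm (T.points (i + 2))]
    refine lt_of_le_of_ne (dist_triangle _ _ _) fun h => hseg ?_
    rw [mem_segment_iff_wbtw]
    exact dist_add_dist_eq_iff.1 h.symm
  have hs : 0 < dist (T.points (i + 1)) X + dist (T.points (i + 2)) X := add_pos hβ hγ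
  set t : ℝ := dist (T.points (i + 1)) X /
    (dist (T.points (i + 1)) X + dist (T.points (i + 2)) X) with ht
  have ht0 : 0 < t := div_pos hβ hs
  have ht1 : t < 1 := by
    rw [ht, div_lt_one hs]
    linarith
  have h1t : 1 - t = dist (T.points (i + 2)) X /
      (dist (T.points (i + 1)) X + dist (T.points (i + 2)) X) := by
    rw [ht]
    field_simp
    ring
  refine ⟨AffineMap.lineMap (T.points (i + 1)) (T.points (i + 2)) t, _,
    sbtw_lineMap_iff.2 ⟨points_ne T i, ht0, ht1⟩, ?_, (one_lt_div ha).2 hlt, ?_, ?_, rfl⟩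
  · have hM : AffineMap.lineMap (T.points (i + 1)) (T.points (i + 2)) t - X =
        (1 / (dist (T.points (i + 1)) X + dist (T.points (i + 2)) X)) •
        (‖T.points (i + 2) - X‖ • (T.points (i + 1) - X) +
          ‖T.points (i + 1) - X‖ • (T.points (i + 2) - X)) := by
      rw [← dist_eq_norm, ← dist_eq_norm, smul_add, smul_smul, smul_smul, one_div_mul_eq_div,
        one_div_mul_eq_div, ← ht, ← h1t]
      ext j
      simp only [PiLp.sub_apply, lineMap_coord, PiLp.add_apply, PiLp.smul_apply, smul_eq_mul]
      ring
    rw [EuclideanGeometry.angle, EuclideanGeometry.angle, vsub_eq_sub, vsub_eq_sub, vsub_eq_sub, hM,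
      InnerProductGeometry.angle_smul_right_of_pos _ _ (one_div_pos.2 hs),
      InnerProductGeometry.angle_smul_left_of_pos _ _ (one_div_pos.2 hs)]
    exact angle_bisector_eq (by rwa [← dist_eq_norm]) (by rwa [← dist_eq_norm])
  · rw [dist_left_lineMap, Real.norm_of_nonneg ht0.le, ht]
    change _ = _ * (_ * sideLength T i)
    field_simp
  · rw [dist_right_lineMap, Real.norm_of_nonneg (by linarith), h1t]
    change _ = _ * (_ * sideLength T i)
    field_simp

/-! ### From the pole to the minimizers -/

theorem weightedSum_eq_circumradius_mul (hT' : ∀ i, sideLength T' i = w i) (Y : Plane) :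
    weightedSum T w Y =
      2 * T'.circumradius * weightedSum T (fun i => Real.sin (ang T' i)) Y := by
  rw [weightedSum, weightedSum, Finset.mul_sum]
  refine Finset.sum_congr rfl fun i _ => ?_
  rw [← hT', sideLength_eq]
  ring

theorem isLeast_range_of_isMinimizer {F f : Plane → ℝ} {t : ℝ} (ht : 0 < t)
    (hf : ∀ Y, F Y = t * f Y) {Y : Plane} (hY : IsMinimizer F Y) :
    IsLeast (Set.range f) (F Y / t) := by
  refine ⟨⟨Y, by rw [hf, mul_div_cancel_left₀ _ ht.ne']⟩, ?_⟩
  rintro _ ⟨Z, rfl⟩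
  rw [div_le_iff₀' ht, ← hf]
  exact isMinOn_iff.1 hY Z trivial

theorem prod_div_poleRatio (T T' T₁ : Tri) :
    sideLength T 0 * sideLength T 1 * sideLength T 2 / poleRatio T T' T₁ =
      2 * T'.circumradius * (area T / T₁.circumradius) := by
  have h0 := (sideLength_pos T 0).ne'
  have h1 := (sideLength_pos T 1).ne'
  have h2 := (sideLength_pos T 2).ne'
  have hR := (circumradius_pos T').ne'
  have hR₁ := (circumradius_pos T₁).ne'
  have hD := (abs_pos.2 (det_ne_zero T)).ne'
  rw [poleRatio, area_eq]
  field_simp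

/-- An inner point of the circumscribed circle on a side line is an inner point of the side. -/
theorem bary_pos_of_bary_eq_zero (hp : 0 < power T X) {i : Fin 3} (hi : bary T X i = 0) :
    0 < bary T X (i + 1) ∧ 0 < bary T X (i + 2) := by
  have h1 := bary_cyclic T X i
  rw [power_cyclic T X i, hi, mul_zero, zero_mul, mul_zero, mul_zero, add_zero, add_zero] at hp
  have h2 := (mul_pos_iff_of_pos_left (pow_pos (sideLength_pos T i) 2)).1 hp
  rcases mul_pos_iff.1 h2 with h | h
  · exact h
  · linarith [h.1, h.2]

theorem IsPole.existsUnique_bary_neg (h : IsPole T w X k) (hw : ∀ i, 0 < w i)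
    (hT' : ∀ i, sideLength T' i = w i) (hX : X ∉ T.closedInterior) : ∃! i, bary T X i < 0 := by
  rw [mem_closedInterior_iff] at hX
  push Not at hX
  obtain ⟨i, hi⟩ := hX
  -- two of the sums `α + α₁` cannot exceed `π` since all six angles add up to `2π`
  have hnot : ∀ j, bary T X j < 0 → ¬ bary T X (j + 1) < 0 := by
    intro j h1 h2
    rw [h.bary_neg_iff hw hT'] at h1 h2
    linarith [sum_ang T j, sum_ang T' j, (ang_mem_Ioo T (j + 2)).1, (ang_mem_Ioo T' (j + 2)).1]
  refine ⟨i, hi, ?_⟩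
  have h2 : ¬ bary T X (i + 2) < 0 := fun h2 => hnot _ h2 (by rwa [add_two_add_one])
  exact (forall_cyclic (p := fun j => bary T X j < 0 → j = i) i).2
    ⟨fun _ => rfl, fun h1 => absurd h1 (hnot i hi), fun h3 => absurd h3 h2⟩

theorem bary_of_sbtw {M : Plane} {i : Fin 3}
    (hM : Sbtw ℝ (T.points (i + 1)) M (T.points (i + 2))) :
    bary T M i = 0 ∧ 0 < bary T M (i + 1) ∧ 0 < bary T M (i + 2) := by
  obtain ⟨hw, hB, hC⟩ := hM
  obtain ⟨h0, h1, h2⟩ := (mem_segment_iff T M i).1 (mem_segment_iff_wbtw.2 hw)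
  have hs := bary_cyclic T M i
  refine ⟨h0, lt_of_le_of_ne h1 fun h => hC ?_, lt_of_le_of_ne h2 fun h => hB ?_⟩
  · have b1 := bary_point_self T (i + 2)
    have b2 := bary_point_add_one T (i + 2)
    have b3 := bary_point_add_two T (i + 2)
    rw [add_two_add_one] at b2
    rw [add_two_add_two] at b3
    exact bary_injective ((forall_cyclic i).2 ⟨by rw [h0, b2], by rw [← h, b3], by linarith⟩)
  · have b1 := bary_point_self T (i + 1)
    have b2 := bary_point_add_one T (i + 1)
    have b3 := bary_point_add_two T (i + 1)
    rw [add_one_add_one] at b2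
    rw [add_one_add_two] at b3
    exact bary_injective ((forall_cyclic i).2 ⟨by rw [h0, b3], by linarith, by rw [← h, b2]⟩)

/-- If one weight is at least the sum of the others, the pulls at its vertex do not exceed it. -/
theorem weightedSum_vertex_lt_of_add_le (hw : ∀ i, 0 < w i) {i : Fin 3}
    (h : w (i + 1) + w (i + 2) ≤ w i) (P : Plane) (hP : P ≠ T.points i) :
    weightedSum T w (T.points i) < weightedSum T w P := by
  refine weightedSum_vertex_lt hw i ?_ P hP
  have h1 := hw (i + 1)
  have h2 := hw (i + 2)
  have h3 : w (i + 1) * w (i + 2) * Real.cos (ang T i) ≤ w (i + 1) * w (i + 2) * 1 :=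
    mul_le_mul_of_nonneg_left (Real.cos_le_one _) (mul_pos h1 h2).le
  have h4 : (w (i + 1) + w (i + 2)) ^ 2 ≤ w i ^ 2 := pow_le_pow_left₀ (by linarith) h 2
  linarith

end FermatWeights

theorem mainTheorem4 (T : FermatWeights.Tri) (w : Fin 3 → ℝ) (hw : ∀ i, 0 < w i) :
    -- one weight is at least the sum of the two others
    (∀ i, w (i + 1) + w (i + 2) ≤ w i →
      ∀ Y, FermatWeights.IsMinimizer (FermatWeights.weightedSum T w) Y ↔ Y = T.points i) ∧
    -- the weights satisfy the strict triangle inequalities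
    ((∀ i, w i < w (i + 1) + w (i + 2)) →
      (∃ T' : FermatWeights.Tri, ∀ i, FermatWeights.sideLength T' i = w i) ∧
      ∀ T' : FermatWeights.Tri, (∀ i, FermatWeights.sideLength T' i = w i) →
        ∀ f : FermatWeights.Plane → ℝ,
          f = FermatWeights.weightedSum T (fun i => Real.sin (FermatWeights.ang T' i)) →
        -- minimizing the normalized function `f` is equivalent to the given problem
        (∃ t : ℝ, 0 < t ∧ ∀ Y, FermatWeights.weightedSum T w Y = t * f Y) ∧
        -- existence and uniqueness of the point `X`
        (∃! X : FermatWeights.Plane, ∃ T₁, FermatWeights.HasPedalAngles T T' X T₁) ∧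
        ∀ (X : FermatWeights.Plane) (T₁ : FermatWeights.Tri),
          FermatWeights.HasPedalAngles T T' X T₁ →
          -- the position of `X` in terms of the angles
          (X ∈ T.interior ↔ ∀ i, FermatWeights.ang T i + FermatWeights.ang T' i < Real.pi) ∧
          (∀ i, X ∈ segment ℝ (T.points (i + 1)) (T.points (i + 2)) ↔
            FermatWeights.ang T i + FermatWeights.ang T' i = Real.pi) ∧
          (∀ i, (FermatWeights.sideLine T i).SOppSide (T.points i) X ↔
            Real.pi < FermatWeights.ang T i + FermatWeights.ang T' i) ∧
          -- `X` lies in the closed triangle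
          (X ∈ T.closedInterior →
            (∃! Y, FermatWeights.IsIsogonalConjTypeI T X Y) ∧
            (∀ Y, FermatWeights.IsMinimizer (FermatWeights.weightedSum T w) Y ↔
              FermatWeights.IsIsogonalConjTypeI T X Y) ∧
            IsLeast (Set.range f) (FermatWeights.area T / T₁.circumradius) ∧
            (∀ i, X ∈ segment ℝ (T.points (i + 1)) (T.points (i + 2)) →
              ∀ Y, FermatWeights.IsMinimizer (FermatWeights.weightedSum T w) Y ↔
                Y = T.points i)) ∧
          -- `X` lies outside the closed triangle
          (X ∉ T.closedInterior →
            ∃! i, (FermatWeights.sideLine T i).SOppSide (T.points i) X) ∧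
          (∀ i, (FermatWeights.sideLine T i).SOppSide (T.points i) X →
            (∀ Y, FermatWeights.IsMinimizer (FermatWeights.weightedSum T w) Y ↔
              Y = T.points i) ∧
            ∃ (M : FermatWeights.Plane) (q : ℝ),
              Sbtw ℝ (T.points (i + 1)) M (T.points (i + 2)) ∧
              ∠ (T.points (i + 1)) X M = ∠ M X (T.points (i + 2)) ∧
              1 < q ∧
              dist (T.points (i + 1)) X = q * dist (T.points (i + 1)) M ∧
              dist (T.points (i + 2)) X = q * dist (T.points (i + 2)) M ∧
              (∀ Y, FermatWeights.IsMinimizer (FermatWeights.weightedSum T w) Y ↔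
                FermatWeights.IsIsogonalConjTypeI T M Y) ∧
              IsLeast (Set.range f) (q * FermatWeights.area T / T₁.circumradius))) := by
  open FermatWeights in
  refine ⟨fun i hi => isMinimizer_iff_of_lt (weightedSum_vertex_lt_of_add_le hw hi), fun htri =>
    ⟨exists_triangle hw htri, fun T' hT' f hf => ?_⟩⟩
  subst hf
  have hscale := weightedSum_eq_circumradius_mul (T := T) hT'
  have hR' : 0 < 2 * T'.circumradius := mul_pos two_pos (circumradius_pos T')
  refine ⟨⟨_, hR', hscale⟩, ?_, fun X T₁ h => ?_⟩
  · obtain ⟨X, k, hX⟩ := exists_isPole T T'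
    rw [funext hT'] at hX
    refine ⟨X, hX.exists_hasPedalAngles hT' htri, ?_⟩
    rintro X' ⟨T₁, h⟩
    exact (h.isPole hT').unique hT' hX
  have hX := h.isPole hT'
  have hvertex : ∀ i, bary T X i ≤ 0 →
      ∀ Y, IsMinimizer (weightedSum T w) Y ↔ Y = T.points i := fun i hi =>
    isMinimizer_iff_of_lt (hX.weightedSum_vertex_lt hw hT' hi)
  have hseg : ∀ i, X ∈ segment ℝ (T.points (i + 1)) (T.points (i + 2)) ↔ bary T X i = 0 := by
    intro i
    rw [mem_segment_iff]
    exact ⟨fun h => h.1, fun h => ⟨h, (bary_pos_of_bary_eq_zero hX.power_pos h).1.le,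
      (bary_pos_of_bary_eq_zero hX.power_pos h).2.le⟩⟩
  have hleast : ∀ i, bary T X i ≤ 0 →
      IsLeast (Set.range (weightedSum T fun i => Real.sin (ang T' i)))
        ((dist (T.points (i + 1)) X + dist (T.points (i + 2)) X) / sideLength T i *
          area T / T₁.circumradius) := by
    intro i hi
    have h1 := isLeast_range_of_isMinimizer hR' hscale ((hvertex i hi _).2 rfl)
    rw [hX.weightedSum_vertex, prod_div_poleRatio] at h1
    convert h1 using 1
    have := (circumradius_pos T').ne'
    field_simp
  refine ⟨?_, fun i => ?_, fun i => ?_, fun hin => ?_, fun hout => ?_, fun i hi => ?_⟩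
  · rw [mem_interior_iff]
    exact forall_congr' fun i => hX.bary_pos_iff hw hT' i
  · rw [hseg, hX.bary_eq_zero_iff hw hT']
  · rw [sOppSide_iff, hX.bary_neg_iff hw hT']
  · rw [mem_closedInterior_iff] at hin
    have hside : ∀ i, X ∈ segment ℝ (T.points (i + 1)) (T.points (i + 2)) →
        ∀ Y, IsMinimizer (weightedSum T w) Y ↔ Y = T.points i := fun i hi =>
      hvertex i ((hseg i).1 hi).le
    by_cases hpos : ∀ i, 0 < bary T X i
    · have hmin : ∀ Y, IsMinimizer (weightedSum T w) Y ↔ Y = conj T X :=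
        isMinimizer_iff_of_lt (hX.weightedSum_conj_lt hpos)
      refine ⟨⟨conj T X, (isIsogonalConjTypeI_interior_iff hpos _).2 rfl, fun Y hY =>
        (isIsogonalConjTypeI_interior_iff hpos Y).1 hY⟩, fun Y => ?_, ?_, hside⟩
      · rw [hmin, isIsogonalConjTypeI_interior_iff hpos]
      · have h1 := isLeast_range_of_isMinimizer hR' hscale ((hmin _).2 rfl)
        rwa [hX.weightedSum_conj hpos, prod_div_poleRatio, mul_div_cancel_left₀ _ hR'.ne'] at h1
    · push Not at hpos
      obtain ⟨i, hi⟩ := hpos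
      have h0 : bary T X i = 0 := le_antisymm hi (hin i)
      obtain ⟨h1, h2⟩ := bary_pos_of_bary_eq_zero hX.power_pos h0
      have hiso := isIsogonalConjTypeI_side_iff h0 h1 h2
      refine ⟨⟨T.points i, (hiso _).2 rfl, fun Y hY => (hiso Y).1 hY⟩, fun Y => ?_, ?_, hside⟩
      · rw [hvertex i hi, hiso]
      · have hd : dist (T.points (i + 1)) X + dist (T.points (i + 2)) X = sideLength T i := by
          rw [dist_comm (T.points (i + 2))]
          exact dist_add_dist_eq_iff.2 (mem_segment_iff_wbtw.1 ((hseg i).2 h0))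
        have h3 := hleast i hi
        rwa [hd, div_self (sideLength_pos T i).ne', one_mul] at h3
  · simp only [sOppSide_iff]
    exact hX.existsUnique_bary_neg hw hT' hout
  · rw [sOppSide_iff] at hi
    refine ⟨hvertex i hi.le, ?_⟩
    obtain ⟨M, q, hM, hangle, hq, hB, hC, rfl⟩ := exists_bisecting_point hi
    refine ⟨M, _, hM, hangle, hq, hB, hC, fun Y => ?_, hleast i hi.le⟩
    have hMb := bary_of_sbtw hM
    rw [hvertex i hi.le, isIsogonalConjTypeI_side_iff hMb.1 hMb.2.1 hMb.2.2]
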